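/- Let $(V,g)$ be a finite-dimensional real vector space with a positive definite inner product, and let \[\mathcal T(V)=\{K\in \mathrm{End}\,V : K^2=-1,\ g(K\cdot,K\cdot)=g(\cdot,\cdot)\},\] a submanifold of $\mathrm{End}\,V$ with tangent spaces $T_K\mathcal T(V)=\mathfrak o_{\{K\}}=\{A\in\mathfrak o(V,g) : AK+KA=0\}$ and complex structure $I_{\mathcal T}A=KA$ for $A\in T_K\mathcal T(V)$. For a field of endomorphisms $F\colon K\mapsto F|_K\in\mathrm{End}\,V$ on $\mathcal T(V)$ let $\mathcal D^F$ be the (possibly singular) distribution \[\mathcal D^F|_K=\{B\in\mathfrak o_{\{K\}} : B(\mathrm{Ker}\,F|_K)=0,\ B(\mathrm{Im}\,F|_K)\subseteq \mathrm{Im}\,F|_K\}.\] Fix $J\in\mathcal T(V)$ and write $\phi|_K=K$. Let $S\in\{\mathbb 1,\ J+\phi,\ J-\phi,\ [J,\phi]\}$ and let $Q=a_k\{J,\phi\}^k+\dots+a_1\{J,\phi\}+a_0\mathbb 1$, where $\{A,B\}=AB+BA$ and $a_0,\dots,a_k\in C^\infty(\mathcal T(V))$. Suppose that $da_i(B)=0$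 for all $i$, all $L\in\mathcal T(V)$ and all $B\in\mathcal D^{S}|_L$. Let $K\in\mathcal T(V)$. With respect to the orthogonal, $K$-invariant splitting $V=\mathrm{Ker}\,QS|_K\oplus\mathrm{Im}\,QS|_K$ write $K=K^a\oplus K^b$, and put \[\mathcal T^{QS}_K=\{K'=K^a\oplus K'^b : K'^b\in\mathcal T(\mathrm{Im}\,QS|_K),\ \mathrm{Im}\,QS|_{K'}=\mathrm{Im}\,QS|_K\}.\] Then the connected component of $\mathcal T^{QS}_K$ that contains $K$ is the leaf of $\mathcal D^{QS}$ through $K$, i.e. it is a connected immersed integral manifold of $\mathcal D^{QS}$ that contains $K$ and contains every connected immersed integral manifold of $\mathcal D^{QS}$ that meets it. Moreover, it is an embedded complex submanifold of $(\mathcal T(V),I_{\mathcal T})$. -/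

import Mathlib

open scoped Manifold ContDiff InnerProductSpace

universe u

namespace Twistor

noncomputable section

section Algebra

variable {V : Type u} [NormedAddCommGroup V] [InnerProductSpace ℝ V]

/-- The twistor space `T(V)`: orthogonal complex structures on `V`, as a subset of `End V`. -/
def twistorSpace (V : Type u) [NormedAddCommGroup V] [InnerProductSpace ℝ V] :
    Set (V →L[ℝ] V) :=
  {J | J * J = -1 ∧ ∀ x y : V, ⟪J x, J y⟫_ℝ = ⟪x, y⟫_ℝ}

/-- The tangent space of `T(V)` at `K`, as a subspace of `End V`: the skew-symmetric
endomorphisms that anticommute with `K`. -/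
def skewAnti (K : V →L[ℝ] V) : Submodule ℝ (V →L[ℝ] V) where
  carrier := {A | (∀ x y : V, ⟪A x, y⟫_ℝ = -⟪x, A y⟫_ℝ) ∧ A * K + K * A = 0}
  zero_mem' := by simp
  add_mem' := by
    rintro A B ⟨hA, hA'⟩ ⟨hB, hB'⟩
    refine ⟨fun x y => ?_, ?_⟩
    · simp only [add_apply, inner_add_left, inner_add_right, hA, hB]
      ring
    · calc (A + B) * K + K * (A + B) = (A * K + K * A) + (B * K + K * B) := by noncomm_ring
        _ = 0 := by rw [hA', hB', add_zero]
  smul_mem' := by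
    rintro c A ⟨hA, hA'⟩
    refine ⟨fun x y => ?_, ?_⟩
    · simp [real_inner_smul_left, real_inner_smul_right, hA]
    · rw [smul_mul_assoc, mul_smul_comm, ← smul_add, hA', smul_zero]

/-- The almost complex structure `I_T A = K A` for `A` tangent to `T(V)` at `K`. -/
def almostComplex (K A : V →L[ℝ] V) : V →L[ℝ] V := K * A

/-- The distribution `D^F` of a field of endomorphisms `F`: at `K` it consists of the tangent
vectors of `T(V)` at `K` that vanish on `Ker F|_K` and map `Im F|_K` to itself. -/
def distribution (F : (V →L[ℝ] V) → (V →L[ℝ] V)) (K : V →L[ℝ] V) :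
    Submodule ℝ (V →L[ℝ] V) where
  carrier := {B | B ∈ skewAnti K ∧ (∀ x : V, F K x = 0 → B x = 0) ∧
    ∀ x ∈ (F K).range, B x ∈ (F K).range}
  zero_mem' := ⟨Submodule.zero_mem _, fun _ _ => rfl, fun _ _ => Submodule.zero_mem _⟩
  add_mem' := by
    rintro A B ⟨hA, hA', hA''⟩ ⟨hB, hB', hB''⟩
    exact ⟨Submodule.add_mem _ hA hB, fun x hx => by simp [hA' x hx, hB' x hx],
      fun x hx => Submodule.add_mem _ (hA'' x hx) (hB'' x hx)⟩
  smul_mem' := by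
    rintro c A ⟨hA, hA', hA''⟩
    exact ⟨Submodule.smul_mem _ c hA, fun x hx => by simp [hA' x hx],
      fun x hx => Submodule.smul_mem _ c (hA'' x hx)⟩

/-- The four admissible fields `1`, `J + φ`, `J - φ`, `[J, φ]`, where `φ|_K = K`. -/
def admissibleS (J : V →L[ℝ] V) : Set ((V →L[ℝ] V) → (V →L[ℝ] V)) :=
  {fun _ => 1, fun K => J + K, fun K => J - K, fun K => J * K - K * J}

/-- `Q = a_k {J, φ}^k + ... + a_1 {J, φ} + a_0 1`, where `φ|_K = K`. -/
def polyQ (J : V →L[ℝ] V) {k : ℕ} (a : Fin (k + 1) → (V →L[ℝ] V) → ℝ) (K : V →L[ℝ] V) :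
    V →L[ℝ] V :=
  ∑ i : Fin (k + 1), a i K • (J * K + K * J) ^ (i : ℕ)

/-- `T^F_K`: all `K' = K^a ⊕ K'^b` with respect to `V = Ker F|_K ⊕ Im F|_K`, where `K^a` is the
restriction of `K` to the kernel, `K'^b` is in the twistor space of the image, and
`Im F|_{K'} = Im F|_K`. -/
def leafSet (F : (V →L[ℝ] V) → (V →L[ℝ] V)) (K : V →L[ℝ] V) : Set (V →L[ℝ] V) :=
  {K' | (∀ x : V, F K x = 0 → K' x = K x) ∧
    (∃ L ∈ twistorSpace (F K).range, ∀ x : (F K).range, K' x = L x) ∧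
    (F K').range = (F K).range}

/-- `X` is a (smooth, embedded) complex submanifold of `T(V)` with its complex structure `I_T`:
it is covered by relatively open pieces, each the homeomorphic image of an open set of some `ℂ^k`
under a smooth immersion `f` that is holomorphic, i.e. `df (i v) = I_T (df v)`. -/
def IsComplexSubmanifold (X : Set (V →L[ℝ] V)) : Prop :=
  X ⊆ twistorSpace V ∧
  ∀ p ∈ X, ∃ (k : ℕ) (U : Set (EuclideanSpace ℂ (Fin k)))
    (f : EuclideanSpace ℂ (Fin k) → (V →L[ℝ] V)),
    IsOpen U ∧ p ∈ f '' U ∧ ContDiffOn ℝ ∞ f U ∧ Set.InjOn f U ∧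
    (∀ U' ⊆ U, IsOpen U' → ∃ O : Set (V →L[ℝ] V), IsOpen O ∧ f '' U' = X ∩ O) ∧
    ∀ z ∈ U, Function.Injective (fderiv ℝ f z) ∧
      ∀ v, fderiv ℝ f z (Complex.I • v) = almostComplex (f z) (fderiv ℝ f z v)

end Algebra

section Leaves

variable {E : Type u} [NormedAddCommGroup E] [NormedSpace ℝ E]

/-- `Y` is a connected integral manifold, inside `M ⊆ E`, of the (possibly singular) distribution
`D`: it is the image of a connected, Hausdorff, second countable smooth manifold under an injective
immersion whose differential has image `D` at every point. -/
def IsConnectedIntegralManifold (M : Set E) (D : E → Submodule ℝ E) (Y : Set E) : Prop :=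
  Y ⊆ M ∧
  ∃ (d : ℕ) (N : Type u) (_ : TopologicalSpace N) (_ : ChartedSpace (EuclideanSpace ℝ (Fin d)) N)
    (ι : N → E),
    IsManifold (𝓡 d) ∞ N ∧ T2Space N ∧ SecondCountableTopology N ∧ ConnectedSpace N ∧
    ContMDiff (𝓡 d) 𝓘(ℝ, E) ∞ ι ∧ Function.Injective ι ∧ Set.range ι = Y ∧
    ∀ x : N, Function.Injective (mfderiv (𝓡 d) 𝓘(ℝ, E) ι x) ∧
      Set.range (mfderiv (𝓡 d) 𝓘(ℝ, E) ι x) = (D (ι x) : Set E)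

/-- `X` is the leaf of `D` through `p`: the maximal connected integral manifold containing `p`. -/
structure IsLeaf (M : Set E) (D : E → Submodule ℝ E) (p : E) (X : Set E) : Prop where
  integral : IsConnectedIntegralManifold M D X
  mem : p ∈ X
  maximal : ∀ Y : Set E, IsConnectedIntegralManifold M D Y → (X ∩ Y).Nonempty → Y ⊆ X

end Leaves

end

end Twistor

set_option linter.unusedSectionVars false

namespace Twistor

noncomputable section

section StarAlgebra

variable {V : Type u} [NormedAddCommGroup V] [InnerProductSpace ℝ V] [FiniteDimensional ℝ V]

theorem star_eq_neg_iff_inner (A : V →L[ℝ] V) :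
    star A = -A ↔ ∀ x y : V, ⟪A x, y⟫_ℝ = -⟪x, A y⟫_ℝ := by
  rw [ContinuousLinearMap.star_eq_adjoint]
  constructor
  · intro h x y
    rw [← ContinuousLinearMap.adjoint_inner_right, h]
    simp
  · intro h
    refine ContinuousLinearMap.ext fun y => ext_inner_left ℝ fun x => ?_
    rw [ContinuousLinearMap.adjoint_inner_right, h]
    simp

theorem mem_skewAnti_iff {K A : V →L[ℝ] V} :
    A ∈ skewAnti K ↔ star A = -A ∧ A * K = -(K * A) := by
  rw [star_eq_neg_iff_inner, ← add_eq_zero_iff_eq_neg]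
  rfl

theorem mem_twistorSpace_iff {K : V →L[ℝ] V} :
    K ∈ twistorSpace V ↔ K * K = -1 ∧ star K = -K := by
  refine and_congr_right fun h => ?_
  have hK : ∀ y, K (K y) = -y := fun y => by
    simpa using congrArg (fun T : V →L[ℝ] V => T y) h
  rw [star_eq_neg_iff_inner]
  constructor
  · intro h' x y
    rw [← h' x (K y), hK, inner_neg_right, neg_neg]
  · intro h' x y
    rw [h', hK, inner_neg_right, neg_neg]

/-- The endomorphisms in `skewAnti p` that vanish on `M`. -/
def skewAntiOn (M : Submodule ℝ V) (p : V →L[ℝ] V) : Submodule ℝ (V →L[ℝ] V) where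
  carrier := {B | B ∈ skewAnti p ∧ ∀ v ∈ M, B v = 0}
  zero_mem' := ⟨Submodule.zero_mem _, fun _ _ => rfl⟩
  add_mem' := by
    rintro A B ⟨hA, hA'⟩ ⟨hB, hB'⟩
    exact ⟨Submodule.add_mem _ hA hB, fun x hx => by simp [hA' x hx, hB' x hx]⟩
  smul_mem' := by
    rintro c A ⟨hA, hA'⟩
    exact ⟨Submodule.smul_mem _ c hA, fun x hx => by simp [hA' x hx]⟩

theorem skewAntiOn_apply_mem {M : Submodule ℝ V} {p B : V →L[ℝ] V} (hB : B ∈ skewAntiOn M p)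
    (v : V) : B v ∈ Mᗮ := by
  rw [Submodule.mem_orthogonal']
  intro m hm
  rw [hB.1.1 v m, hB.2 m hm, inner_zero_right, neg_zero]

theorem twistor_sq_apply {p : V →L[ℝ] V} (hp : p ∈ twistorSpace V) (v : V) : p (p v) = -v := by
  simpa using congrArg (fun T : V →L[ℝ] V => T v) hp.1

theorem twistor_inner {p : V →L[ℝ] V} (hp : p ∈ twistorSpace V) (v w : V) :
    ⟪p v, w⟫_ℝ = -⟪v, p w⟫_ℝ :=
  (star_eq_neg_iff_inner p).1 (mem_twistorSpace_iff.1 hp).2 v w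

theorem twistor_mapsTo_orthogonal {M : Submodule ℝ V} {p : V →L[ℝ] V} (hp : p ∈ twistorSpace V)
    (hM : ∀ v ∈ M, p v ∈ M) {v : V} (hv : v ∈ Mᗮ) : p v ∈ Mᗮ := by
  rw [Submodule.mem_orthogonal'] at hv ⊢
  intro m hm
  rw [twistor_inner hp, hv _ (hM m hm), neg_zero]

/-- Left multiplication by `p` preserves `skewAntiOn M p`. -/
theorem mul_mem_skewAntiOn {M : Submodule ℝ V} {p B : V →L[ℝ] V} (hp : p ∈ twistorSpace V)
    (hB : B ∈ skewAntiOn M p) : p * B ∈ skewAntiOn M p := by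
  obtain ⟨h1, h2⟩ := mem_skewAnti_iff.1 hB.1
  obtain ⟨-, hp2⟩ := mem_twistorSpace_iff.1 hp
  refine ⟨mem_skewAnti_iff.2 ⟨?_, ?_⟩, fun v hv => by simp [hB.2 v hv]⟩
  · rw [star_mul, h1, hp2, neg_mul_neg, h2]
  · rw [mul_assoc, h2, mul_neg]

/-- Conjugating by an intertwiner `C` of `p` and `x`. -/
theorem conj_mem_skewAntiOn {M N : Submodule ℝ V} {p x C B : V →L[ℝ] V}
    (hp : p ∈ twistorSpace V) (hx : x ∈ twistorSpace V) (hC : C * p = x * C)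
    (hN : ∀ v ∈ N, star C v ∈ M) (hB : B ∈ skewAntiOn M p) :
    C * B * star C ∈ skewAntiOn N x := by
  obtain ⟨h1, h2⟩ := mem_skewAnti_iff.1 hB.1
  obtain ⟨-, hp2⟩ := mem_twistorSpace_iff.1 hp
  obtain ⟨-, hx2⟩ := mem_twistorSpace_iff.1 hx
  have hC' : star C * x = p * star C := by
    have := congrArg star hC
    rw [star_mul, star_mul, hp2, hx2, neg_mul, mul_neg, neg_inj] at this
    exact this.symm
  refine ⟨mem_skewAnti_iff.2 ⟨?_, ?_⟩, fun v hv => by simp [hB.2 _ (hN v hv)]⟩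
  · simp [star_mul, h1, mul_assoc]
  · calc C * B * star C * x = C * (B * p) * star C := by simp only [mul_assoc, hC']
      _ = -((C * p) * B * star C) := by rw [h2]; noncomm_ring
      _ = _ := by rw [hC]; noncomm_ring

/-- Conjugation by `C` as a linear map between the spaces `skewAntiOn`. -/
def conjSkewAntiOn {M N : Submodule ℝ V} {p x C : V →L[ℝ] V}
    (hp : p ∈ twistorSpace V) (hx : x ∈ twistorSpace V) (hC : C * p = x * C)
    (hN : ∀ v ∈ N, star C v ∈ M) : skewAntiOn M p →ₗ[ℝ] skewAntiOn N x where
  toFun B := ⟨C * B * star C, conj_mem_skewAntiOn hp hx hC hN B.2⟩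
  map_add' A B := by ext1; simp [mul_add, add_mul]
  map_smul' c B := by ext1; simp

theorem conjSkewAntiOn_injective {M N : Submodule ℝ V} {p x C : V →L[ℝ] V}
    (hp : p ∈ twistorSpace V) (hx : x ∈ twistorSpace V) (hC : C * p = x * C)
    (hN : ∀ v ∈ N, star C v ∈ M) (hinj : ∀ w ∈ Mᗮ, C w = 0 → w = 0) :
    Function.Injective (conjSkewAntiOn hp hx hC hN) := by
  rw [injective_iff_map_eq_zero]
  rintro ⟨B, hB⟩ h
  have h0 : C * B * star C = 0 := congrArg Subtype.val h
  have h1 : B * star C = 0 := by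
    ext v
    refine hinj _ (skewAntiOn_apply_mem hB _) ?_
    simpa using congrArg (fun T : V →L[ℝ] V => T v) h0
  have h2 : C * B = 0 := by
    have := congrArg star h1
    rw [star_mul, star_star, (mem_skewAnti_iff.1 hB.1).1, star_zero, mul_neg, neg_eq_zero] at this
    exact this
  ext v
  refine hinj _ (skewAntiOn_apply_mem hB _) ?_
  simpa using congrArg (fun T : V →L[ℝ] V => T v) h2

/-- A vector annihilated by a nonzero space `skewAntiOn M x` lies in `M`. -/
theorem mem_of_forall_skewAntiOn_apply_eq_zero {M : Submodule ℝ V} {x : V →L[ℝ] V}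
    (hx : x ∈ twistorSpace V) (hM : ∀ v ∈ M, x v ∈ M) {B₀ : V →L[ℝ] V}
    (hB₀ : B₀ ∈ skewAntiOn M x) (hne : B₀ ≠ 0) {z : V}
    (hz : ∀ B ∈ skewAntiOn M x, B z = 0) : z ∈ M := by
  obtain ⟨m, hm, u, hu, rfl⟩ := Submodule.exists_add_mem_mem_orthogonal (K := M) z
  have hu0 : ∀ B ∈ skewAntiOn M x, B u = 0 := fun B hB => by
    simpa [hB.2 m hm] using hz B hB
  obtain ⟨v, hv⟩ : ∃ v, B₀ v ≠ 0 := by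
    by_contra! h
    exact hne (ContinuousLinearMap.ext h)
  set w := B₀ v with hw
  have hanti : ∀ v, B₀ (x v) = -(x (B₀ v)) := fun v => by
    simpa using congrArg (fun T : V →L[ℝ] V => T v) (mem_skewAnti_iff.1 hB₀.1).2
  have hwu : ⟪w, u⟫_ℝ = 0 := by
    rw [hw, hB₀.1.1, hu0 _ hB₀, inner_zero_right, neg_zero]
  have hwxu : ⟪w, x u⟫_ℝ = 0 := by
    rw [hw, hB₀.1.1, hanti, hu0 _ hB₀]
    simp
  have hxw : ⟪x w, u⟫_ℝ = 0 := by rw [twistor_inner hx, hwxu, neg_zero]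
  have hxu : ⟪x u, u⟫_ℝ = 0 := by
    have := twistor_inner hx u u
    rw [real_inner_comm (x u) u] at this
    linarith
  let B : V →L[ℝ] V := (innerSL ℝ w).smulRight u - (innerSL ℝ u).smulRight w
    - (innerSL ℝ (x w)).smulRight (x u) + (innerSL ℝ (x u)).smulRight (x w)
  have hBv : ∀ y, B y = ⟪w, y⟫_ℝ • u - ⟪u, y⟫_ℝ • w - ⟪x w, y⟫_ℝ • x u + ⟪x u, y⟫_ℝ • x w :=
    fun y => by simp [B]
  have hwM : w ∈ Mᗮ := skewAntiOn_apply_mem hB₀ v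
  have hB : B ∈ skewAntiOn M x := by
    refine ⟨⟨fun y y' => ?_, ?_⟩, fun y hy => ?_⟩
    · simp only [hBv, inner_add_left, inner_sub_left, real_inner_smul_left,
        real_inner_comm _ y]
      ring
    · ext y
      have e : ∀ a, ⟪a, x y⟫_ℝ = -⟪x a, y⟫_ℝ := fun a => by rw [twistor_inner hx, neg_neg]
      simp only [add_apply, mul_apply_eq_comp, hBv, e, map_add, map_sub,
        map_smul, twistor_sq_apply hx, inner_neg_left]
      simp only [zero_apply]
      module
    · rw [hBv]
      simp only [Submodule.inner_left_of_mem_orthogonal hy hwM,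
        Submodule.inner_left_of_mem_orthogonal hy hu,
        Submodule.inner_left_of_mem_orthogonal hy (twistor_mapsTo_orthogonal hx hM hu),
        Submodule.inner_left_of_mem_orthogonal hy (twistor_mapsTo_orthogonal hx hM hwM)]
      simp
  have h := hu0 B hB
  rw [hBv, hwu, hxw, hxu] at h
  simp only [zero_smul, zero_sub, sub_zero, add_zero, neg_eq_zero, smul_eq_zero,
    inner_self_eq_zero] at h
  rw [h.resolve_right hv, add_zero]
  exact hm

/-- Operators close to one that is injective on `W` are uniformly bounded below on `W`. -/
theorem exists_eventually_le_norm_apply (W : Submodule ℝ V) (R : V →L[ℝ] V)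
    (hR : ∀ w ∈ W, R w = 0 → w = 0) :
    ∃ c > 0, ∀ᶠ R' in nhds R, ∀ w ∈ W, c * ‖w‖ ≤ ‖R' w‖ := by
  have hker : ((R : V →ₗ[ℝ] V).comp W.subtype).ker = ⊥ := by
    rw [LinearMap.ker_eq_bot']
    rintro ⟨w, hw⟩ h
    exact Subtype.ext (hR w hw (by simpa using h))
  obtain ⟨K, hK, hanti⟩ := LinearMap.exists_antilipschitzWith _ hker
  have hK' : (0 : ℝ) < K := hK
  refine ⟨(2 * K : ℝ)⁻¹, by positivity, ?_⟩
  filter_upwards [Metric.closedBall_mem_nhds R (show (0 : ℝ) < (2 * K : ℝ)⁻¹ by positivity)]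
    with R' hR' w hw
  have h1 : ‖w‖ ≤ K * ‖R w‖ := by
    simpa using (ZeroHomClass.bound_of_antilipschitz _ hanti) (⟨w, hw⟩ : W)
  have h2 : ‖R w‖ ≤ ‖R' w‖ + (2 * K : ℝ)⁻¹ * ‖w‖ := by
    have h3 : ‖(R' - R) w‖ ≤ (2 * K : ℝ)⁻¹ * ‖w‖ :=
      ((R' - R).le_opNorm w).trans (by
        gcongr; simpa [dist_eq_norm] using hR')
    calc ‖R w‖ = ‖R' w - (R' - R) w‖ := by simp
      _ ≤ ‖R' w‖ + ‖(R' - R) w‖ := norm_sub_le _ _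
      _ ≤ _ := by gcongr
  have h4 : (K : ℝ)⁻¹ * ‖w‖ ≤ ‖R w‖ := by
    rw [inv_mul_le_iff₀ hK']; exact h1
  have h5 : (K : ℝ)⁻¹ = (2 * K : ℝ)⁻¹ + (2 * K : ℝ)⁻¹ := by field_simp; norm_num
  rw [h5, add_mul] at h4
  linarith

end StarAlgebra

section Fields

variable {V : Type u} [NormedAddCommGroup V] [InnerProductSpace ℝ V] [FiniteDimensional ℝ V]

theorem commute_anticommutator_right {J x : V →L[ℝ] V} (hx : x * x = -1) :
    Commute (J * x + x * J) x := by
  have h1 : (J * x + x * J) * x = J * (x * x) + x * J * x := by noncomm_ring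
  have h2 : x * (J * x + x * J) = x * J * x + x * x * J := by noncomm_ring
  rw [Commute, SemiconjBy, h1, h2, hx]
  noncomm_ring

theorem commute_anticommutator_left {J x : V →L[ℝ] V} (hJ : J * J = -1) :
    Commute (J * x + x * J) J := by
  rw [add_comm]
  exact commute_anticommutator_right hJ

theorem commute_polyQ {J x A : V →L[ℝ] V} {k : ℕ} (a : Fin (k + 1) → (V →L[ℝ] V) → ℝ)
    (h : Commute (J * x + x * J) A) : Commute (polyQ J a x) A :=
  Commute.sum_left _ _ _ fun _ _ => (h.pow_left _).smul_left _

theorem star_polyQ {J x : V →L[ℝ] V} (hJ : J ∈ twistorSpace V) (hx : x ∈ twistorSpace V) {k : ℕ}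
    (a : Fin (k + 1) → (V →L[ℝ] V) → ℝ) : star (polyQ J a x) = polyQ J a x := by
  have h : star (J * x + x * J) = J * x + x * J := by
    simp [star_mul, (mem_twistorSpace_iff.1 hJ).2, (mem_twistorSpace_iff.1 hx).2, add_comm]
  simp [polyQ, star_sum, star_smul, star_pow, h]

/-- The algebraic relations at `x` that are shared by all fields `F = Q S`. -/
structure FieldRelations (J x F : V →L[ℝ] V) : Prop where
  star_eq : star F = F ∨ star F = -F
  mul_self_right : ∃ Z : V →L[ℝ] V, Commute (J * x + x * J) Z ∧ F * x = Z * F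
  mul_base_right : ∃ Z : V →L[ℝ] V, Commute (J * x + x * J) Z ∧ F * J = Z * F
  sq_comm : F * F * x = x * (F * F)
  comm : Commute (J * x + x * J) F

theorem FieldRelations.of_admissible {J x : V →L[ℝ] V} (hJ : J ∈ twistorSpace V)
    (hx : x ∈ twistorSpace V) {S : (V →L[ℝ] V) → (V →L[ℝ] V)} (hS : S ∈ admissibleS J) :
    FieldRelations J x (S x) := by
  obtain ⟨J1, J2⟩ := mem_twistorSpace_iff.1 hJ
  obtain ⟨x1, x2⟩ := mem_twistorSpace_iff.1 hx
  have cJ := commute_anticommutator_left (x := x) J1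
  have cx := commute_anticommutator_right (J := J) x1
  have ex : ∀ y : V →L[ℝ] V, y * x * x = -y := fun y => by rw [mul_assoc, x1, mul_neg_one]
  have eJ : ∀ y : V →L[ℝ] V, y * J * J = -y := fun y => by rw [mul_assoc, J1, mul_neg_one]
  rcases hS with rfl | rfl | rfl | rfl
  · exact ⟨by simp, ⟨x, cx, by simp⟩, ⟨J, cJ, by simp⟩, by simp, Commute.one_right _⟩
  · refine ⟨Or.inr (by simp [J2, x2, add_comm]), ⟨J, cJ, ?_⟩, ⟨x, cx, ?_⟩, ?_, cJ.add_right cx⟩ <;>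
      simp only [add_mul, mul_add, ← mul_assoc, ex, x1, J1, neg_mul, mul_neg, one_mul, mul_one] <;> abel
  · refine ⟨Or.inr (by rw [star_sub, J2, x2, neg_sub_neg, neg_sub]), ⟨-J, cJ.neg_right, ?_⟩, ⟨-x, cx.neg_right, ?_⟩, ?_,
      cJ.sub_right cx⟩ <;>
      simp only [sub_mul, mul_sub, ← mul_assoc, ex, x1, J1, neg_mul] <;> noncomm_ring
  · refine ⟨Or.inr (by simp [J2, x2, star_mul]), ⟨-x, cx.neg_right, ?_⟩, ⟨-J, cJ.neg_right, ?_⟩, ?_,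
      (cJ.mul_right cx).sub_right (cx.mul_right cJ)⟩ <;>
      simp only [sub_mul, mul_sub, ← mul_assoc, ex, eJ, x1, J1, neg_mul] <;> noncomm_ring

theorem FieldRelations.polyQ_mul {J x S : V →L[ℝ] V} (hJ : J ∈ twistorSpace V)
    (hx : x ∈ twistorSpace V) (hS : FieldRelations J x S) {k : ℕ}
    (a : Fin (k + 1) → (V →L[ℝ] V) → ℝ) : FieldRelations J x (polyQ J a x * S) := by
  have cx := commute_anticommutator_right (J := J) hx.1
  have cQ : Commute (J * x + x * J) (polyQ J a x) := (commute_polyQ a (Commute.refl _)).symm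
  have qS := commute_polyQ a hS.comm
  have qx := commute_polyQ a cx
  refine ⟨?_, ?_, ?_, ?_, cQ.mul_right hS.comm⟩
  · rw [star_mul, star_polyQ hJ hx]
    rcases hS.star_eq with h | h
    · left; rw [h, qS.eq]
    · right; rw [h, neg_mul, qS.eq]
  · obtain ⟨Z, hZ, h⟩ := hS.mul_self_right
    exact ⟨Z, hZ, by rw [mul_assoc, h, ← mul_assoc, (commute_polyQ a hZ).eq, mul_assoc]⟩
  · obtain ⟨Z, hZ, h⟩ := hS.mul_base_right
    exact ⟨Z, hZ, by rw [mul_assoc, h, ← mul_assoc, (commute_polyQ a hZ).eq, mul_assoc]⟩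
  · have e : polyQ J a x * S * (polyQ J a x * S) = polyQ J a x * polyQ J a x * (S * S) := by
      rw [mul_assoc, ← mul_assoc S, ← qS.eq]; noncomm_ring
    rw [e, mul_assoc, hS.sq_comm, ← mul_assoc, (qx.mul_left qx).eq, mul_assoc]

namespace FieldRelations

variable {J x F : V →L[ℝ] V}

theorem apply_self_eq_zero (h : FieldRelations J x F) {v : V} (hv : F v = 0) : F (x v) = 0 := by
  obtain ⟨Z, -, hZ⟩ := h.mul_self_right
  simpa [hv] using congrArg (fun T : V →L[ℝ] V => T v) hZ

theorem apply_base_eq_zero (h : FieldRelations J x F) {v : V} (hv : F v = 0) : F (J v) = 0 := by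
  obtain ⟨Z, -, hZ⟩ := h.mul_base_right
  simpa [hv] using congrArg (fun T : V →L[ℝ] V => T v) hZ

theorem ker_star (h : FieldRelations J x F) : (star F).ker = F.ker := by
  rcases h.star_eq with h | h <;> rw [h]
  ext v; simp

theorem orthogonal_ker (h : FieldRelations J x F) : F.kerᗮ = F.range := by
  rw [← h.ker_star, ContinuousLinearMap.star_eq_adjoint, ← ContinuousLinearMap.orthogonal_range,
    Submodule.orthogonal_orthogonal]

theorem orthogonal_range (h : FieldRelations J x F) : F.rangeᗮ = F.ker := by
  rw [← h.orthogonal_ker, Submodule.orthogonal_orthogonal]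

/-- `F` is injective on its image. -/
theorem eq_zero_of_mem_orthogonal (_h : FieldRelations J x F) {w : V} (hw : w ∈ F.kerᗮ)
    (h0 : F w = 0) : w = 0 := by
  have := Submodule.inner_left_of_mem_orthogonal (K := F.ker) (u := w) (v := w) h0 hw
  exact inner_self_eq_zero.1 this

end FieldRelations

theorem distribution_eq_skewAntiOn {J x : V →L[ℝ] V} {F : (V →L[ℝ] V) → (V →L[ℝ] V)}
    (h : FieldRelations J x (F x)) : distribution F x = skewAntiOn (F x).ker x := by
  ext B
  constructor
  · rintro ⟨h1, h2, -⟩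
    exact ⟨h1, fun v hv => h2 v hv⟩
  · intro hB
    refine ⟨hB.1, fun v hv => hB.2 v hv, fun v _ => ?_⟩
    rw [← h.orthogonal_ker]
    exact skewAntiOn_apply_mem hB v

end Fields

end

end Twistor

namespace Twistor

noncomputable section

section Cayley

variable {V : Type u} [NormedAddCommGroup V] [InnerProductSpace ℝ V] [FiniteDimensional ℝ V]

/-- The Cayley-type parametrisation `A ↦ (1 + A) p (1 + A)⁻¹` of the twistor space around `p`,
written as `p (2 (1 + A)⁻¹ - 1)`. -/
def cayley (p A : V →L[ℝ] V) : V →L[ℝ] V := p * ((2 : ℝ) • Ring.inverse (1 + A) - 1)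

/-- The inverse of `cayley p`. -/
def cayleyInv (p x : V →L[ℝ] V) : V →L[ℝ] V := (2 : ℝ) • Ring.inverse (1 - p * x) - 1

theorem ringInverse_eq {R : Type*} [Ring R] {a b : R} (h : a * b = 1) (h' : b * a = 1) :
    Ring.inverse a = b :=
  Ring.inverse_unit ⟨a, b, h, h'⟩

theorem isUnit_of_injective {A : V →L[ℝ] V} (h : ∀ v, A v = 0 → v = 0) : IsUnit A := by
  have hinj : Function.Injective A := (injective_iff_map_eq_zero A).2 h
  rw [ContinuousLinearMap.isUnit_iff_bijective]
  exact ⟨hinj, (LinearMap.injective_iff_surjective (f := (A : V →ₗ[ℝ] V))).1 hinj⟩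

theorem isUnit_one_add {A : V →L[ℝ] V} (hA : star A = -A) : IsUnit (1 + A) := by
  refine isUnit_of_injective fun v hv => ?_
  have h1 := (star_eq_neg_iff_inner A).1 hA v v
  have h2 : v + A v = 0 := by simpa using hv
  have h3 : ⟪v, v⟫_ℝ + ⟪A v, v⟫_ℝ = 0 := by rw [← inner_add_left, h2, inner_zero_left]
  rw [real_inner_comm (A v) v] at h1
  exact (inner_self_eq_zero (𝕜 := ℝ)).1 (by linarith)

/-- The inverses of `1 + A` and `1 - A` for `A` skew and anticommuting with `p`. -/
theorem exists_inverse_pair {p A : V →L[ℝ] V} (hA : A ∈ skewAnti p) :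
    ∃ R R' : V →L[ℝ] V, R * (1 + A) = 1 ∧ (1 + A) * R = 1 ∧ R' * (1 - A) = 1 ∧
      (1 - A) * R' = 1 ∧ star R = R' ∧ R * p = p * R' ∧ R' * p = p * R ∧
      Ring.inverse (1 + A) = R := by
  obtain ⟨h1, h2⟩ := mem_skewAnti_iff.1 hA
  have hu := isUnit_one_add h1
  have hR1 := Ring.inverse_mul_cancel _ hu
  have hR2 := Ring.mul_inverse_cancel _ hu
  set R := Ring.inverse (1 + A) with hR
  have hs : star (1 + A) = 1 - A := by rw [star_add, star_one, h1, sub_eq_add_neg]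
  have hR3 : star R * (1 - A) = 1 := by rw [← hs, ← star_mul, hR2, star_one]
  have hR4 : (1 - A) * star R = 1 := by rw [← hs, ← star_mul, hR1, star_one]
  have c1 : p * (1 - A) = (1 + A) * p := by rw [add_mul, mul_sub, h2]; noncomm_ring
  have c2 : p * (1 + A) = (1 - A) * p := by rw [sub_mul, mul_add, h2]; noncomm_ring
  refine ⟨R, star R, hR1, hR2, hR3, hR4, rfl, ?_, ?_, rfl⟩
  · calc R * p = R * (p * (1 - A)) * star R := by rw [mul_assoc, mul_assoc, hR4, mul_one]
      _ = (R * (1 + A)) * p * star R := by rw [c1]; noncomm_ring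
      _ = _ := by rw [hR1, one_mul]
  · calc star R * p = star R * (p * (1 + A)) * R := by rw [mul_assoc, mul_assoc, hR2, mul_one]
      _ = (star R * (1 - A)) * p * R := by rw [c2]; noncomm_ring
      _ = _ := by rw [hR3, one_mul]

theorem cayley_zero (p : V →L[ℝ] V) : cayley p 0 = p := by
  rw [cayley, add_zero, Ring.inverse_one, two_smul, add_sub_cancel_right, mul_one]

theorem cayley_mem_twistorSpace {p A : V →L[ℝ] V} (hp : p ∈ twistorSpace V)
    (hA : A ∈ skewAnti p) : cayley p A ∈ twistorSpace V := by
  obtain ⟨R, R', h1, h2, h3, h4, hs, c1, c2, hR⟩ := exists_inverse_pair hA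
  obtain ⟨p1, p2⟩ := mem_twistorSpace_iff.1 hp
  rw [mem_twistorSpace_iff, cayley, hR]
  constructor
  · have e1 : (2 : ℝ) • R - 1 = (1 - A) * R := by
      calc (2 : ℝ) • R - 1 = (2 : ℝ) • R - (1 + A) * R := by rw [h2]
        _ = _ := by rw [two_smul]; noncomm_ring
    have e2 : (2 : ℝ) • R' - 1 = (1 + A) * R' := by
      calc (2 : ℝ) • R' - 1 = (2 : ℝ) • R' - (1 - A) * R' := by rw [h4]
        _ = _ := by rw [two_smul]; noncomm_ring
    calc p * ((2 : ℝ) • R - 1) * (p * ((2 : ℝ) • R - 1))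
        = p * (((2 : ℝ) • R - 1) * p) * ((2 : ℝ) • R - 1) := by noncomm_ring
      _ = p * p * (((2 : ℝ) • R' - 1) * ((2 : ℝ) • R - 1)) := by
          rw [sub_mul, smul_mul_assoc, c1, one_mul]
          simp only [mul_sub, sub_mul, mul_smul_comm, smul_mul_assoc, mul_one, one_mul, mul_assoc]
      _ = -((1 + A) * (R' * (1 - A)) * R) := by rw [p1, e1, e2]; noncomm_ring
      _ = -1 := by rw [h3, mul_one, h2]
  · rw [star_mul, star_sub, star_smul, hs, p2, star_one, star_trivial, mul_neg, sub_mul,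
      smul_mul_assoc, c2, one_mul, mul_sub, mul_smul_comm, mul_one]

theorem cayley_apply_of_apply_eq_zero {p A : V →L[ℝ] V}
    (hA : A ∈ skewAnti p) {v : V} (hv : A v = 0) : cayley p A v = p v := by
  obtain ⟨R, R', h1, h2, h3, h4, hs, c1, c2, hR⟩ := exists_inverse_pair hA
  have h : R v = v := by
    simpa [hv] using congrArg (fun T : V →L[ℝ] V => T v) h1
  rw [cayley, hR]
  simp [h, two_smul]

theorem one_sub_mul_cayley {p : V →L[ℝ] V} (hp : p ∈ twistorSpace V) (A : V →L[ℝ] V) :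
    1 - p * cayley p A = (2 : ℝ) • Ring.inverse (1 + A) := by
  rw [cayley, ← mul_assoc, hp.1, neg_one_mul, neg_sub, sub_sub_cancel]

theorem isUnit_one_sub_mul_cayley {p A : V →L[ℝ] V} (hp : p ∈ twistorSpace V)
    (hA : A ∈ skewAnti p) : IsUnit (1 - p * cayley p A) := by
  rw [one_sub_mul_cayley hp]
  exact (isUnit_one_add (mem_skewAnti_iff.1 hA).1).ringInverse.smul (Units.mk0 (2 : ℝ) two_ne_zero)

theorem cayleyInv_cayley {p A : V →L[ℝ] V} (hp : p ∈ twistorSpace V) (hA : A ∈ skewAnti p) :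
    cayleyInv p (cayley p A) = A := by
  obtain ⟨R, R', h1, h2, h3, h4, hs, c1, c2, hR⟩ := exists_inverse_pair hA
  rw [cayleyInv, one_sub_mul_cayley hp, hR, ringInverse_eq (b := (2⁻¹ : ℝ) • (1 + A))]
  · rw [smul_smul]; norm_num
  · rw [smul_mul_smul_comm, h1]; norm_num
  · rw [smul_mul_smul_comm, h2]; norm_num

theorem cayley_cayleyInv {p x : V →L[ℝ] V} (hp : p ∈ twistorSpace V)
    (hu : IsUnit (1 - p * x)) : cayley p (cayleyInv p x) = x := by
  have h1 := Ring.inverse_mul_cancel _ hu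
  have h2 := Ring.mul_inverse_cancel _ hu
  rw [cayley, cayleyInv, add_sub_cancel, ringInverse_eq (b := (2⁻¹ : ℝ) • (1 - p * x))]
  · rw [smul_smul, mul_inv_cancel₀ two_ne_zero, one_smul, sub_sub_cancel_left, mul_neg,
      ← mul_assoc, hp.1]
    noncomm_ring
  · rw [smul_mul_smul_comm, h1]; norm_num
  · rw [smul_mul_smul_comm, h2]; norm_num

theorem cayleyInv_self {p : V →L[ℝ] V} (hp : p ∈ twistorSpace V) : cayleyInv p p = 0 := by
  have h := cayleyInv_cayley hp (A := 0) (Submodule.zero_mem _)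
  rwa [cayley_zero] at h

theorem cayleyInv_mem {M : Submodule ℝ V} {p x : V →L[ℝ] V} (hp : p ∈ twistorSpace V)
    (hx : x ∈ twistorSpace V) (hxp : ∀ v ∈ M, x v = p v)
    (hu : IsUnit (1 - p * x)) : cayleyInv p x ∈ skewAntiOn M p := by
  obtain ⟨p1, p2⟩ := mem_twistorSpace_iff.1 hp
  obtain ⟨x1, x2⟩ := mem_twistorSpace_iff.1 hx
  have h1 := Ring.inverse_mul_cancel _ hu
  have h2 := Ring.mul_inverse_cancel _ hu
  rw [cayleyInv]
  set R := Ring.inverse (1 - p * x) with hR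
  have hs : star (1 - p * x) = 1 - x * p := by simp [star_mul, p2, x2]
  have h3 : star R * (1 - x * p) = 1 := by rw [← hs, ← star_mul, h2, star_one]
  have h4 : (1 - x * p) * star R = 1 := by rw [← hs, ← star_mul, h1, star_one]
  have e1 : R + star R = 1 := by
    have : (1 - p * x) * (R + star R) * (1 - x * p) = (1 - p * x) * (1 - x * p) := by
      calc _ = ((1 - p * x) * R) * (1 - x * p) + (1 - p * x) * (star R * (1 - x * p)) := by
            noncomm_ring
        _ = 1 - x * p + (1 - p * x) := by rw [h2, h3, one_mul, mul_one]
        _ = 1 - x * p - p * x + p * -1 * p := by rw [mul_neg_one, neg_mul, p1]; noncomm_ring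
        _ = 1 - x * p - p * x + p * (x * x) * p := by rw [x1]
        _ = _ := by noncomm_ring
    calc R + star R = R * ((1 - p * x) * (R + star R) * (1 - x * p)) * star R := by
          rw [mul_assoc (1 - p * x), ← mul_assoc R, h1, one_mul, mul_assoc, h4, mul_one]
      _ = (R * (1 - p * x)) * ((1 - x * p) * star R) := by rw [this]; noncomm_ring
      _ = 1 := by rw [h1, h4, one_mul]
  have e2 : R * p + p * R = p := by
    have : (1 - p * x) * (R * p + p * R) * (1 - p * x) = (1 - p * x) * p * (1 - p * x) := by
      calc _ = ((1 - p * x) * R) * p * (1 - p * x) + (1 - p * x) * p * (R * (1 - p * x)) := by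
            noncomm_ring
        _ = p - p * p * x + (p - p * x * p) := by rw [h1, h2]; noncomm_ring
        _ = p + x + (p - p * x * p) := by rw [p1]; noncomm_ring
        _ = p - p * p * x + (p * (x * (p * p)) * x - p * x * p) := by
          have e : p * (x * (p * p)) * x = p := by
            rw [p1, mul_neg_one, mul_neg, neg_mul, mul_assoc, x1, mul_neg_one, neg_neg]
          rw [e, p1]; noncomm_ring
        _ = _ := by noncomm_ring
    calc R * p + p * R = R * ((1 - p * x) * (R * p + p * R) * (1 - p * x)) * R := by
          rw [mul_assoc (1 - p * x), ← mul_assoc R, h1, one_mul, mul_assoc, h2, mul_one]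
      _ = (R * (1 - p * x)) * p * ((1 - p * x) * R) := by rw [this]; noncomm_ring
      _ = p := by rw [h1, h2, one_mul, mul_one]
  refine ⟨mem_skewAnti_iff.2 ⟨?_, ?_⟩, fun v hv => ?_⟩
  · rw [star_sub, star_smul, star_one, star_trivial, eq_sub_of_add_eq' e1, two_smul, two_smul]
    abel
  · rw [sub_mul, mul_sub, smul_mul_assoc, mul_smul_comm, eq_sub_of_add_eq e2, smul_sub, two_smul ℝ p]
    simp only [one_mul, mul_one]
    abel
  · have h : (1 - p * x) v = (2 : ℝ) • v := by
      simp [hxp v hv, twistor_sq_apply hp, two_smul]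
    have h' : R ((1 - p * x) v) = v := by
      simpa using congrArg (fun T : V →L[ℝ] V => T v) h1
    rw [h, map_smul] at h'
    simp [h']

theorem hasFDerivAt_cayley {p A : V →L[ℝ] V} (hA : IsUnit (1 + A)) :
    HasFDerivAt (cayley p)
      ((-2 : ℝ) • ((ContinuousLinearMap.mul ℝ (V →L[ℝ] V) p).comp
        (ContinuousLinearMap.mulLeftRight ℝ (V →L[ℝ] V) (Ring.inverse (1 + A))
          (Ring.inverse (1 + A))))) A := by
  obtain ⟨u, hu⟩ := hA
  have h1 : HasFDerivAt (fun B : V →L[ℝ] V => 1 + B)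
      (ContinuousLinearMap.id ℝ (V →L[ℝ] V)) A := (hasFDerivAt_id A).const_add 1
  have h2 := hasFDerivAt_ringInverse (𝕜 := ℝ) u
  rw [hu] at h2
  have h3 := (ContinuousLinearMap.mul ℝ (V →L[ℝ] V) p).hasFDerivAt.comp A
    (((h2.comp A h1).const_smul (2 : ℝ)).sub_const 1)
  refine HasFDerivAt.congr_fderiv (f := cayley p) h3 ?_
  ext1 B
  simp [← hu]

theorem contDiffAt_cayley {p A : V →L[ℝ] V} (hA : IsUnit (1 + A)) : ContDiffAt ℝ ∞ (cayley p) A := by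
  obtain ⟨u, hu⟩ := hA
  have h2 : ContDiffAt ℝ ∞ Ring.inverse (1 + A) := hu ▸ contDiffAt_ringInverse ℝ u
  have h3 : ContDiffAt ℝ ∞ (fun B : V →L[ℝ] V => Ring.inverse (1 + B)) A :=
    h2.comp A (contDiffAt_const.add contDiffAt_id)
  exact contDiffAt_const.mul ((h3.const_smul (2 : ℝ)).sub contDiffAt_const)

theorem contDiffAt_cayleyInv {p x : V →L[ℝ] V} (hx : IsUnit (1 - p * x)) :
    ContDiffAt ℝ ∞ (cayleyInv p) x := by
  obtain ⟨u, hu⟩ := hx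
  have h2 : ContDiffAt ℝ ∞ Ring.inverse (1 - p * x) := hu ▸ contDiffAt_ringInverse ℝ u
  have h3 : ContDiffAt ℝ ∞ (fun y : V →L[ℝ] V => Ring.inverse (1 - p * y)) x :=
    h2.comp x (contDiffAt_const.sub (contDiffAt_const.mul contDiffAt_id))
  exact (h3.const_smul (2 : ℝ)).sub contDiffAt_const

/-- The derivative of `cayley p` intertwines left multiplication by `p` with left multiplication
by `cayley p A`. -/
theorem mul_cayley_deriv {p A : V →L[ℝ] V} (hA : A ∈ skewAnti p) (B : V →L[ℝ] V) :
    p * (Ring.inverse (1 + A) * (p * B) * Ring.inverse (1 + A)) =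
      cayley p A * (p * (Ring.inverse (1 + A) * B * Ring.inverse (1 + A))) := by
  obtain ⟨R, R', h1, h2, h3, h4, hs, c1, c2, hR⟩ := exists_inverse_pair hA
  rw [cayley, hR]
  have e2 : ((2 : ℝ) • R' - 1) * R = R' := by
    have : (2 : ℝ) • R' - 1 = R' * (1 + A) := by
      calc (2 : ℝ) • R' - 1 = (2 : ℝ) • R' - R' * (1 - A) := by rw [h3]
        _ = _ := by rw [two_smul]; noncomm_ring
    rw [this, mul_assoc, h2, mul_one]
  calc p * (R * (p * B) * R) = p * (R * p) * B * R := by noncomm_ring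
    _ = p * p * R' * B * R := by rw [c1]; noncomm_ring
    _ = p * p * (((2 : ℝ) • R' - 1) * R) * B * R := by rw [e2]
    _ = p * ((2 : ℝ) • (p * R') - p) * (R * B * R) := by
      simp only [mul_sub, sub_mul, mul_smul_comm, smul_mul_assoc, mul_assoc, one_mul]
    _ = _ := by
      rw [← c1]
      simp only [mul_sub, sub_mul, mul_smul_comm, smul_mul_assoc, mul_assoc, mul_one]

theorem cayley_deriv_injective {p A B : V →L[ℝ] V} (hp : p ∈ twistorSpace V)
    (hA : IsUnit (1 + A))
    (h : p * (Ring.inverse (1 + A) * B * Ring.inverse (1 + A)) = 0) : B = 0 := by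
  have h1 := Ring.inverse_mul_cancel _ hA
  have h2 := Ring.mul_inverse_cancel _ hA
  set R := Ring.inverse (1 + A)
  calc B = ((1 + A) * R) * B * (R * (1 + A)) := by rw [h1, h2, one_mul, mul_one]
    _ = -((1 + A) * (p * p) * (R * B * R) * (1 + A)) := by rw [hp.1]; noncomm_ring
    _ = -((1 + A) * p * (p * (R * B * R)) * (1 + A)) := by noncomm_ring
    _ = 0 := by rw [h]; simp

end Cayley

section Tangent

variable {V : Type u} [NormedAddCommGroup V] [InnerProductSpace ℝ V] [FiniteDimensional ℝ V]

/-- Velocities of curves in the twistor space that are constant on `M`. -/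
theorem mem_skewAntiOn_of_hasDerivAt {M : Submodule ℝ V} {y : ℝ → V →L[ℝ] V} {B : V →L[ℝ] V}
    {t : ℝ} (hy : ∀ s, y s ∈ twistorSpace V) (hM : ∀ s, ∀ v ∈ M, y s v = y t v)
    (h : HasDerivAt y B t) : B ∈ skewAntiOn M (y t) := by
  refine ⟨⟨fun v w => ?_, ?_⟩, fun v hv => ?_⟩
  · have h1 : HasDerivAt (fun s => ⟪y s v, w⟫_ℝ + ⟪v, y s w⟫_ℝ) (⟪B v, w⟫_ℝ + ⟪v, B w⟫_ℝ) t := by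
      have a1 : HasDerivAt (fun s => y s v) (B v) t := by
        simpa using h.clm_apply (hasDerivAt_const t v)
      have a2 : HasDerivAt (fun s => y s w) (B w) t := by
        simpa using h.clm_apply (hasDerivAt_const t w)
      have a3 := (a1.inner ℝ (hasDerivAt_const t w)).add ((hasDerivAt_const t v).inner ℝ a2)
      simp only [inner_zero_left, inner_zero_right, zero_add, add_zero] at a3
      exact a3
    have h2 : (fun s => ⟪y s v, w⟫_ℝ + ⟪v, y s w⟫_ℝ) = fun _ => 0 := by
      ext s; rw [twistor_inner (hy s)]; ring
    rw [h2] at h1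
    have := h1.unique (hasDerivAt_const t 0)
    linarith
  · have h1 := h.mul h
    have h2 : (y * y) = fun _ => -1 := by
      ext1 s; exact (hy s).1
    rw [h2] at h1
    exact h1.unique (hasDerivAt_const t _)
  · have a1 : HasDerivAt (fun s => y s v) (B v) t := by
      simpa using h.clm_apply (hasDerivAt_const t v)
    have h2 : (fun s => y s v) = fun _ => y t v := by ext1 s; exact hM s v hv
    rw [h2] at a1
    exact a1.unique (hasDerivAt_const t _)

end Tangent

end

end Twistor

namespace Twistor

noncomputable section

section LeafSet

variable {V : Type u} [NormedAddCommGroup V] [InnerProductSpace ℝ V] [FiniteDimensional ℝ V]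

theorem mem_twistorSpace_of_mem_leafSet {J p x : V →L[ℝ] V} {F : (V →L[ℝ] V) → (V →L[ℝ] V)}
    (hp : p ∈ twistorSpace V) (hF : FieldRelations J p (F p)) (hx : x ∈ leafSet F p) :
    x ∈ twistorSpace V := by
  obtain ⟨h1, ⟨L, hL, h2⟩, -⟩ := hx
  have dec : ∀ v : V, ∃ m ∈ (F p).ker, ∃ w : (F p).range, v = m + w := fun v => by
    obtain ⟨m, hm, w, hw, rfl⟩ := Submodule.exists_add_mem_mem_orthogonal (K := (F p).ker) v
    rw [hF.orthogonal_ker] at hw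
    exact ⟨m, hm, ⟨w, hw⟩, rfl⟩
  have orth : ∀ m ∈ (F p).ker, ∀ w : (F p).range, ⟪m, (w : V)⟫_ℝ = 0 := fun m hm w =>
    Submodule.inner_right_of_mem_orthogonal hm (by rw [hF.orthogonal_ker]; exact w.2)
  have pm : ∀ m ∈ (F p).ker, p m ∈ (F p).ker := fun m hm => hF.apply_self_eq_zero hm
  constructor
  · ext v
    obtain ⟨m, hm, w, rfl⟩ := dec v
    have e1 : x (x m) = -m := by rw [h1 m hm, h1 _ (pm m hm), twistor_sq_apply hp]
    have e2 : x (x w) = -(w : V) := by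
      rw [h2, h2]
      have := congrArg (fun T : (F p).range →L[ℝ] (F p).range => T w) hL.1
      have := congrArg Subtype.val this
      simpa using this
    simp [e1, e2, add_comm]
  · intro v v'
    obtain ⟨m, hm, w, rfl⟩ := dec v
    obtain ⟨m', hm', w', rfl⟩ := dec v'
    have e1 : ⟪((L w : (F p).range) : V), (L w' : (F p).range)⟫_ℝ = ⟪(w : V), w'⟫_ℝ := hL.2 w w'
    have e2 : ⟪((L w : (F p).range) : V), p m'⟫_ℝ = 0 := by
      rw [real_inner_comm]; exact orth _ (pm m' hm') _
    have e3 : ⟪(w : V), m'⟫_ℝ = 0 := by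
      rw [real_inner_comm]; exact orth _ hm' _
    simp only [map_add, h1 m hm, h1 m' hm', h2, inner_add_left, inner_add_right, e1, e2, e3,
      orth _ (pm m hm), orth m hm, hp.2]

/-- Membership in `leafSet F p` in terms of kernels. -/
theorem mem_leafSet_iff {J p x : V →L[ℝ] V} {F : (V →L[ℝ] V) → (V →L[ℝ] V)}
    (hF : ∀ y ∈ twistorSpace V, FieldRelations J y (F y)) (hp : p ∈ twistorSpace V) :
    x ∈ leafSet F p ↔ x ∈ twistorSpace V ∧ (∀ v ∈ (F p).ker, x v = p v) ∧
      (F x).ker = (F p).ker := by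
  constructor
  · intro h
    have hx := mem_twistorSpace_of_mem_leafSet hp (hF p hp) h
    refine ⟨hx, fun v hv => h.1 v hv, ?_⟩
    rw [← (hF x hx).orthogonal_range, ← (hF p hp).orthogonal_range, h.2.2]
  · rintro ⟨hx, h1, h2⟩
    have hxr : ∀ v ∈ (F p).range, x v ∈ (F p).range := by
      rw [← (hF p hp).orthogonal_ker]
      refine fun v hv => twistor_mapsTo_orthogonal hx (fun m hm => ?_) hv
      rw [h1 m hm]
      exact (hF p hp).apply_self_eq_zero hm
    refine ⟨fun v hv => h1 v hv, ⟨(x.comp (F p).range.subtypeL).codRestrict (F p).range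
      fun v => hxr v v.2, ⟨?_, fun v w => hx.2 v w⟩, fun v => rfl⟩, ?_⟩
    · ext v
      exact twistor_sq_apply hx (v : V)
    · rw [← (hF x hx).orthogonal_ker, ← (hF p hp).orthogonal_ker, h2]

theorem self_mem_leafSet {J p : V →L[ℝ] V} {F : (V →L[ℝ] V) → (V →L[ℝ] V)}
    (hF : ∀ y ∈ twistorSpace V, FieldRelations J y (F y)) (hp : p ∈ twistorSpace V) :
    p ∈ leafSet F p :=
  (mem_leafSet_iff hF hp).2 ⟨hp, fun _ _ => rfl, rfl⟩

theorem leafSet_eq_of_mem {J p x : V →L[ℝ] V} {F : (V →L[ℝ] V) → (V →L[ℝ] V)}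
    (hF : ∀ y ∈ twistorSpace V, FieldRelations J y (F y)) (hp : p ∈ twistorSpace V)
    (hx : x ∈ leafSet F p) : leafSet F x = leafSet F p := by
  obtain ⟨hx1, hx2, hx3⟩ := (mem_leafSet_iff hF hp).1 hx
  ext y
  rw [mem_leafSet_iff hF hp, mem_leafSet_iff hF hx1, hx3]
  refine and_congr_right fun _ => and_congr_left fun _ => forall₂_congr fun v hv => ?_
  rw [hx2 v hv]

end LeafSet

section LeafField

variable {V : Type u} [NormedAddCommGroup V] [InnerProductSpace ℝ V] [FiniteDimensional ℝ V]

/-- The field of endomorphisms `Q S`. -/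
def leafField (J : V →L[ℝ] V) {k : ℕ} (a : Fin (k + 1) → (V →L[ℝ] V) → ℝ)
    (S : (V →L[ℝ] V) → (V →L[ℝ] V)) (x : V →L[ℝ] V) : V →L[ℝ] V :=
  polyQ J a x * S x

/-- The field `Q S` with constant coefficients. -/
def constField (J : V →L[ℝ] V) {k : ℕ} (c : Fin (k + 1) → ℝ)
    (S : (V →L[ℝ] V) → (V →L[ℝ] V)) : (V →L[ℝ] V) → (V →L[ℝ] V) :=
  leafField J (fun i _ => c i) S

variable {J : V →L[ℝ] V} {S : (V →L[ℝ] V) → (V →L[ℝ] V)} {k : ℕ}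

theorem leafField_relations (hJ : J ∈ twistorSpace V) (hS : S ∈ admissibleS J)
    (a : Fin (k + 1) → (V →L[ℝ] V) → ℝ) :
    ∀ x ∈ twistorSpace V, FieldRelations J x (leafField J a S x) := fun _ hx =>
  (FieldRelations.of_admissible hJ hx hS).polyQ_mul hJ hx a

theorem leafField_eq_constField {a : Fin (k + 1) → (V →L[ℝ] V) → ℝ} {c : Fin (k + 1) → ℝ}
    {x : V →L[ℝ] V} (h : ∀ i, a i x = c i) : leafField J a S x = constField J c S x := by
  simp [leafField, constField, polyQ, h]

theorem contDiff_constField (hS : S ∈ admissibleS J) (c : Fin (k + 1) → ℝ) :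
    ContDiff ℝ ∞ (constField J c S) := by
  have hS' : ContDiff ℝ ∞ S := by
    rcases hS with rfl | rfl | rfl | rfl <;> fun_prop
  have hQ : ContDiff ℝ ∞ (polyQ J (fun i (_ : V →L[ℝ] V) => c i)) := by
    refine ContDiff.sum fun i _ => ContDiff.const_smul (c i) (ContDiff.pow ?_ _)
    fun_prop
  exact hQ.mul hS'

/-- `Q S` at `y` and at `p` agree on subspaces on which `y` and `p` agree. -/
theorem constField_apply_congr (hS : S ∈ admissibleS J) (c : Fin (k + 1) → ℝ)
    {M : Submodule ℝ V} {p y : V →L[ℝ] V} (hJM : ∀ v ∈ M, J v ∈ M) (hpM : ∀ v ∈ M, p v ∈ M)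
    (hy : ∀ v ∈ M, y v = p v) : ∀ v ∈ M, constField J c S y v = constField J c S p v := by
  have hSM : ∀ v ∈ M, S y v = S p v ∧ S p v ∈ M := by
    intro v hv
    have h1 := hJM v hv
    have h2 := hpM v hv
    rcases hS with rfl | rfl | rfl | rfl
    · exact ⟨rfl, hv⟩
    · exact ⟨by simp [hy v hv], M.add_mem h1 h2⟩
    · exact ⟨by simp [hy v hv], M.sub_mem h1 h2⟩
    · exact ⟨by simp [hy v hv, hy _ h1], M.sub_mem (hJM _ h2) (hpM _ h1)⟩
  have hT : ∀ (n : ℕ), ∀ v ∈ M, ((J * y + y * J) ^ n) v = ((J * p + p * J) ^ n) v := by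
    intro n
    induction n with
    | zero => intro v _; rfl
    | succ n ih =>
      intro v hv
      have e : (J * y + y * J) v = (J * p + p * J) v := by simp [hy v hv, hy _ (hJM v hv)]
      rw [pow_succ, pow_succ, mul_apply_eq_comp, mul_apply_eq_comp, e]
      exact ih _ (M.add_mem (hJM _ (hpM v hv)) (hpM _ (hJM v hv)))
  intro v hv
  obtain ⟨h1, h2⟩ := hSM v hv
  simp only [constField, leafField, polyQ, mul_apply_eq_comp, h1, sum_apply,
    smul_apply, hT _ _ h2]

theorem fderiv_apply_eq_zero_of_line {f : (V →L[ℝ] V) → (V →L[ℝ] V)} {p B : V →L[ℝ] V} {v : V}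
    (hf : DifferentiableAt ℝ f p) (h : ∀ s : ℝ, f (p + s • B) v = 0) : fderiv ℝ f p B v = 0 := by
  have h1 : HasDerivAt (fun s : ℝ => p + s • B) B 0 := by
    simpa using ((hasDerivAt_id (0 : ℝ)).smul_const B).const_add p
  have h2 : HasFDerivAt f (fderiv ℝ f p) (p + (0 : ℝ) • B) := by
    rw [zero_smul, add_zero]
    exact hf.hasFDerivAt
  have h3 : HasDerivAt (fun s : ℝ => f (p + s • B)) (fderiv ℝ f p B) 0 :=
    h2.comp_hasDerivAt (0 : ℝ) h1
  have h4 : HasDerivAt (fun s : ℝ => f (p + s • B) v) (fderiv ℝ f p B v) 0 := by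
    simpa using h3.clm_apply (hasDerivAt_const (0 : ℝ) v)
  simp only [h] at h4
  exact h4.unique (hasDerivAt_const (0 : ℝ) (0 : V))

/-- The derivative of `Q S` along a vector that vanishes on the kernel also vanishes there. -/
theorem fderiv_constField_apply_eq_zero (hJ : J ∈ twistorSpace V) (hS : S ∈ admissibleS J)
    (c : Fin (k + 1) → ℝ) {p B : V →L[ℝ] V} (hp : p ∈ twistorSpace V)
    (hB : ∀ v ∈ (constField J c S p).ker, B v = 0) :
    ∀ v ∈ (constField J c S p).ker, fderiv ℝ (constField J c S) p B v = 0 := by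
  intro v hv
  have hF : FieldRelations J p (constField J c S p) := leafField_relations hJ hS _ p hp
  refine fderiv_apply_eq_zero_of_line ((contDiff_constField hS c).differentiable (by simp) p) ?_
  intro s
  rw [constField_apply_congr hS c (M := (constField J c S p).ker)
    (fun w hw => hF.apply_base_eq_zero hw) (fun w hw => hF.apply_self_eq_zero hw)
    (fun w hw => by simp [hB w hw]) v hv]
  exact hv

theorem distribution_leafField_le (hJ : J ∈ twistorSpace V) (hS : S ∈ admissibleS J)
    (a : Fin (k + 1) → (V →L[ℝ] V) → ℝ) {x : V →L[ℝ] V} (hx : x ∈ twistorSpace V) :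
    distribution (leafField J a S) x ≤ distribution S x := by
  rw [distribution_eq_skewAntiOn (leafField_relations hJ hS a x hx),
    distribution_eq_skewAntiOn (FieldRelations.of_admissible hJ hx hS)]
  refine fun B hB => ⟨hB.1, fun v hv => hB.2 v ?_⟩
  have hv' : S x v = 0 := hv
  simp [leafField, hv']

/-- The coefficients of `Q` are constant along curves tangent to `D^S`. -/
theorem coefficient_eq_of_tangent {a : (V →L[ℝ] V) → ℝ}
    (ha : ContDiffOn ℝ ∞ a (twistorSpace V))
    (hint : ∀ L ∈ twistorSpace V, ∀ B ∈ distribution S L,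
      fderivWithin ℝ a (twistorSpace V) L B = 0)
    {γ γ' : ℝ → V →L[ℝ] V} (hγ : ∀ t ∈ Set.Icc (0 : ℝ) 1, HasDerivWithinAt γ (γ' t) (Set.Icc 0 1) t)
    (hγT : ∀ t ∈ Set.Icc (0 : ℝ) 1, γ t ∈ twistorSpace V)
    (hγD : ∀ t ∈ Set.Icc (0 : ℝ) 1, γ' t ∈ distribution S (γ t)) :
    ∀ t ∈ Set.Icc (0 : ℝ) 1, a (γ t) = a (γ 0) := by
  have h : ∀ t ∈ Set.Icc (0 : ℝ) 1, HasDerivWithinAt (a ∘ γ) 0 (Set.Icc 0 1) t := by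
    intro t ht
    have h1 := ((ha.differentiableOn (by simp)) (γ t) (hγT t ht)).hasFDerivWithinAt
    have h2 := h1.comp_hasDerivWithinAt t (hγ t ht) hγT
    rwa [hint _ (hγT t ht) _ (hγD t ht)] at h2
  exact constant_of_derivWithin_zero (fun t ht => (h t ht).differentiableWithinAt)
    fun t ht => (h t ⟨ht.1, ht.2.le⟩).derivWithin
      (uniqueDiffOn_Icc one_pos t ⟨ht.1, ht.2.le⟩)

/-- Small elements of the distribution at `p` are sent into `leafSet p` by `cayley p`. -/
theorem exists_cayley_mem_leafSet (hJ : J ∈ twistorSpace V) (hS : S ∈ admissibleS J)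
    {a : Fin (k + 1) → (V →L[ℝ] V) → ℝ} (ha : ∀ i, ContDiffOn ℝ ∞ (a i) (twistorSpace V))
    (hint : ∀ i, ∀ L ∈ twistorSpace V, ∀ B ∈ distribution S L,
      fderivWithin ℝ (a i) (twistorSpace V) L B = 0)
    {p : V →L[ℝ] V} (hp : p ∈ twistorSpace V) :
    ∃ ε > 0, ∀ A ∈ distribution (leafField J a S) p, ‖A‖ < ε →
      cayley p A ∈ leafSet (leafField J a S) p := by
  have hrel := leafField_relations hJ hS a
  have hF := hrel p hp
  obtain ⟨c, hc⟩ : ∃ c : Fin (k + 1) → ℝ, ∀ i, a i p = c i := ⟨fun i => a i p, fun _ => rfl⟩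
  obtain ⟨G, hG⟩ : ∃ G, G = constField J c S := ⟨_, rfl⟩
  have hGp : leafField J a S p = G p := by rw [hG, leafField_eq_constField hc]
  have hGc : Continuous G := by rw [hG]; exact (contDiff_constField hS c).continuous
  rw [distribution_eq_skewAntiOn hF]
  rw [hGp] at hF ⊢
  obtain ⟨δ, hδ, hev⟩ := exists_eventually_le_norm_apply (G p).kerᗮ (G p)
    fun w hw h => hF.eq_zero_of_mem_orthogonal hw h
  have hcont : ContinuousAt (fun A => G (cayley p A)) 0 := by
    have h1 : ContinuousAt (cayley p) 0 := (contDiffAt_cayley (by simp)).continuousAt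
    exact ContinuousAt.comp (g := G) hGc.continuousAt h1
  have hev' := hcont.eventually (p := fun R' => ∀ w ∈ (G p).kerᗮ, δ * ‖w‖ ≤ ‖R' w‖)
    (by simpa only [cayley_zero] using hev)
  obtain ⟨ε, hε, hball⟩ := Metric.eventually_nhds_iff_ball.1 hev'
  refine ⟨ε, hε, fun A hA hAε => ?_⟩
  have hmem : ∀ t : ℝ, t • A ∈ skewAntiOn (G p).ker p := fun t => Submodule.smul_mem _ t hA
  have hT : ∀ t : ℝ, cayley p (t • A) ∈ twistorSpace V := fun t =>
    cayley_mem_twistorSpace hp (hmem t).1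
  have hagree : ∀ t : ℝ, ∀ v ∈ (G p).ker, cayley p (t • A) v = p v := fun t v hv =>
    cayley_apply_of_apply_eq_zero (hmem t).1 ((hmem t).2 v hv)
  have hzero : ∀ t : ℝ, ∀ v ∈ (G p).ker, G (cayley p (t • A)) v = 0 := fun t v hv => by
    rw [hG, constField_apply_congr hS c (fun w hw => hF.apply_base_eq_zero hw)
      (fun w hw => hF.apply_self_eq_zero hw) (hagree t) v hv, ← hG]
    exact hv
  have hker : ∀ t ∈ Set.Icc (0 : ℝ) 1, ∀ v, G (cayley p (t • A)) v = 0 → v ∈ (G p).ker := by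
    intro t ht v hv
    obtain ⟨m, hm, w, hw, rfl⟩ := Submodule.exists_add_mem_mem_orthogonal (K := (G p).ker) v
    rw [map_add, hzero t m hm, zero_add] at hv
    have hsmall : t • A ∈ Metric.ball (0 : V →L[ℝ] V) ε := by
      rw [mem_ball_zero_iff, norm_smul, Real.norm_of_nonneg ht.1]
      exact (mul_le_of_le_one_left (norm_nonneg _) ht.2).trans_lt hAε
    have h := hball _ hsmall w hw
    rw [hv, norm_zero] at h
    have hw0 : w = 0 := by
      rw [← norm_eq_zero]
      exact le_antisymm (nonpos_of_mul_nonpos_right h hδ) (norm_nonneg _)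
    rw [hw0, add_zero]
    exact hm
  have hder : ∀ t : ℝ, ∃ B, HasDerivAt (fun s : ℝ => cayley p (s • A)) B t := by
    intro t
    have h1 : HasDerivAt (fun s : ℝ => s • A) A t := by
      simpa using (hasDerivAt_id t).smul_const A
    have h2 := hasFDerivAt_cayley (p := p) (isUnit_one_add (mem_skewAnti_iff.1 (hmem t).1).1)
    have h3 := h2.comp_hasDerivAt t h1
    exact ⟨_, h3⟩
  choose B hB using hder
  have hBmem : ∀ t, B t ∈ skewAntiOn (G p).ker (cayley p (t • A)) := fun t =>
    mem_skewAntiOn_of_hasDerivAt (y := fun s : ℝ => cayley p (s • A)) hT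
      (fun s v hv => (hagree s v hv).trans (hagree t v hv).symm) (hB t)
  have hBD : ∀ t ∈ Set.Icc (0 : ℝ) 1, B t ∈ distribution S (cayley p (t • A)) := by
    intro t ht
    rw [distribution_eq_skewAntiOn (FieldRelations.of_admissible hJ (hT t) hS)]
    refine ⟨(hBmem t).1, fun v hv => (hBmem t).2 v (hker t ht v ?_)⟩
    have hv' : S (cayley p (t • A)) v = 0 := hv
    simp [hG, constField, leafField, hv']
  have hconst : ∀ i, a i (cayley p A) = c i := fun i => by
    have := coefficient_eq_of_tangent (ha i) (hint i)
      (γ := fun s : ℝ => cayley p (s • A)) (fun t _ => (hB t).hasDerivWithinAt) (fun t _ => hT t)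
      hBD 1 ⟨zero_le_one, le_rfl⟩
    simpa [cayley_zero, hc] using this
  have hz := hzero 1
  have hk := hker 1 ⟨zero_le_one, le_rfl⟩
  have hag := hagree 1
  have hT1 := hT 1
  rw [one_smul] at hz hk hag hT1
  rw [mem_leafSet_iff hrel hp, hGp, leafField_eq_constField hconst, ← hG]
  exact ⟨hT1, hag, le_antisymm (fun v hv => hk v hv) fun v hv => hz v hv⟩

end LeafField

end

end Twistor

namespace Twistor

noncomputable section

section CayleyAtlas

variable {V : Type u} [NormedAddCommGroup V] [InnerProductSpace ℝ V] [FiniteDimensional ℝ V]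
variable {X : Set (V →L[ℝ] V)} {H : Type*} [NormedAddCommGroup H] [NormedSpace ℝ H]

/-- A linear parametrisation `L` of a subspace of `skewAnti p`, with left inverse `P`, such that
`cayley p ∘ L` parametrises a neighbourhood of `p` in `X`. -/
structure CayleyChart (X : Set (V →L[ℝ] V)) (p : V →L[ℝ] V) (H : Type*) [NormedAddCommGroup H]
    [NormedSpace ℝ H] where
  radius : ℝ
  L : H →L[ℝ] (V →L[ℝ] V)
  P : (V →L[ℝ] V) →L[ℝ] H
  mem : p ∈ X
  mem_twistorSpace : p ∈ twistorSpace V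
  radius_pos : 0 < radius
  left_inv : ∀ v, P (L v) = v
  skew : ∀ v, L v ∈ skewAnti p
  cayley_mem : ∀ v, ‖L v‖ < radius → cayley p (L v) ∈ X
  cayleyInv_mem : ∀ x ∈ X, IsUnit (1 - p * x) → ∃ v, L v = cayleyInv p x

theorem isOpen_isUnit_one_sub_mul (p : V →L[ℝ] V) : IsOpen {y : V →L[ℝ] V | IsUnit (1 - p * y)} :=
  Units.isOpen.preimage (continuous_const.sub (continuous_const.mul continuous_id))

theorem continuousOn_cayleyInv (p : V →L[ℝ] V) :
    ContinuousOn (cayleyInv p) {y : V →L[ℝ] V | IsUnit (1 - p * y)} := fun _ hy =>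
  (contDiffAt_cayleyInv hy).continuousAt.continuousWithinAt

namespace CayleyChart

variable {p : V →L[ℝ] V} (c : CayleyChart X p H)

theorem isUnit_one_add_L (v : H) : IsUnit (1 + c.L v) :=
  isUnit_one_add (mem_skewAnti_iff.1 (c.skew v)).1

theorem contDiff_param : ContDiff ℝ ∞ (fun v => cayley p (c.L v)) :=
  contDiff_iff_contDiffAt.2 fun v =>
    (contDiffAt_cayley (c.isUnit_one_add_L v)).comp v c.L.contDiff.contDiffAt

theorem hasFDerivAt_param (v : H) : HasFDerivAt (fun v => cayley p (c.L v))
    (((-2 : ℝ) • ((ContinuousLinearMap.mul ℝ (V →L[ℝ] V) p).comp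
        (ContinuousLinearMap.mulLeftRight ℝ (V →L[ℝ] V) (Ring.inverse (1 + c.L v))
          (Ring.inverse (1 + c.L v))))).comp c.L) v := by
  have h1 := hasFDerivAt_cayley (p := p) (c.isUnit_one_add_L v)
  have h2 := h1.comp v c.L.hasFDerivAt
  exact h2

theorem P_cayleyInv_cayley (v : H) : c.P (cayleyInv p (cayley p (c.L v))) = v := by
  rw [cayleyInv_cayley c.mem_twistorSpace (c.skew v), c.left_inv]

theorem L_P_cayleyInv {x : V →L[ℝ] V} (hx : x ∈ X) (hu : IsUnit (1 - p * x)) :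
    c.L (c.P (cayleyInv p x)) = cayleyInv p x := by
  obtain ⟨v, hv⟩ := c.cayleyInv_mem x hx hu
  rw [← hv, c.left_inv]

theorem cayley_L_P_cayleyInv {x : V →L[ℝ] V} (hx : x ∈ X) (hu : IsUnit (1 - p * x)) :
    cayley p (c.L (c.P (cayleyInv p x))) = x := by
  rw [c.L_P_cayleyInv hx hu, cayley_cayleyInv c.mem_twistorSpace hu]

open Classical in
/-- The chart of `X` around `p`. -/
def chart : OpenPartialHomeomorph X H where
  toFun x := c.P (cayleyInv p x)
  invFun v := if h : cayley p (c.L v) ∈ X then ⟨_, h⟩ else ⟨p, c.mem⟩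
  source := {x | IsUnit (1 - p * (x : V →L[ℝ] V)) ∧ ‖cayleyInv p x‖ < c.radius}
  target := {v | ‖c.L v‖ < c.radius}
  map_source' := by
    rintro x ⟨h1, h2⟩
    simpa only [Set.mem_ofPred_eq, c.L_P_cayleyInv x.2 h1] using h2
  map_target' := by
    intro v hv
    rw [dif_pos (c.cayley_mem v hv)]
    refine ⟨isUnit_one_sub_mul_cayley c.mem_twistorSpace (c.skew v), ?_⟩
    rwa [cayleyInv_cayley c.mem_twistorSpace (c.skew v)]
  left_inv' := by
    rintro x ⟨h1, -⟩
    have h := c.cayley_L_P_cayleyInv x.2 h1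
    have hX : cayley p (c.L (c.P (cayleyInv p x))) ∈ X := h.symm ▸ x.2
    rw [dif_pos hX]
    exact Subtype.ext h
  right_inv' := by
    intro v hv
    rw [dif_pos (c.cayley_mem v hv)]
    exact c.P_cayleyInv_cayley v
  open_source := by
    have h : IsOpen ({y : V →L[ℝ] V | IsUnit (1 - p * y)} ∩
        cayleyInv p ⁻¹' Metric.ball 0 c.radius) :=
      (continuousOn_cayleyInv p).isOpen_inter_preimage (isOpen_isUnit_one_sub_mul p)
        Metric.isOpen_ball
    convert h.preimage (continuous_subtype_val (p := (· ∈ X))) using 1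
    ext x
    simp
  open_target := isOpen_lt (c.L.continuous.norm) continuous_const
  continuousOn_toFun := by
    refine c.P.continuous.comp_continuousOn ?_
    exact (continuousOn_cayleyInv p).comp continuous_subtype_val.continuousOn fun x hx => hx.1
  continuousOn_invFun := by
    rw [Topology.IsInducing.subtypeVal.continuousOn_iff]
    refine c.contDiff_param.continuous.continuousOn.congr fun v hv => ?_
    simp only [Function.comp_apply]
    rw [dif_pos (c.cayley_mem v hv)]

theorem chart_apply (x : X) : c.chart x = c.P (cayleyInv p x) := rfl

theorem mem_chart_target {v : H} : v ∈ c.chart.target ↔ ‖c.L v‖ < c.radius := Iff.rfl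

theorem mem_chart_source {x : X} :
    x ∈ c.chart.source ↔ IsUnit (1 - p * (x : V →L[ℝ] V)) ∧ ‖cayleyInv p x‖ < c.radius := Iff.rfl

theorem coe_chart_symm {v : H} (hv : v ∈ c.chart.target) :
    (c.chart.symm v : V →L[ℝ] V) = cayley p (c.L v) := by
  exact congrArg Subtype.val (dif_pos (c.cayley_mem v hv))

theorem self_mem_chart_source : (⟨p, c.mem⟩ : X) ∈ c.chart.source := by
  rw [mem_chart_source]
  have h := isUnit_one_sub_mul_cayley c.mem_twistorSpace (A := 0) (Submodule.zero_mem _)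
  rw [cayley_zero] at h
  refine ⟨h, ?_⟩
  simp only [cayleyInv_self c.mem_twistorSpace, norm_zero]
  exact c.radius_pos

theorem chart_self : c.chart ⟨p, c.mem⟩ = 0 := by
  rw [chart_apply, cayleyInv_self c.mem_twistorSpace, map_zero]

/-- The image of an open set of parameters is relatively open. -/
theorem exists_isOpen_image_eq {U : Set H} (hU : IsOpen U)
    (hball : ∀ v ∈ U, ‖c.L v‖ < c.radius) :
    ∃ O : Set (V →L[ℝ] V), IsOpen O ∧ (fun v => cayley p (c.L v)) '' U = X ∩ O := by
  refine ⟨{y | IsUnit (1 - p * y)} ∩ (fun y => c.P (cayleyInv p y)) ⁻¹' U,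
    (c.P.continuous.comp_continuousOn (continuousOn_cayleyInv p)).isOpen_inter_preimage
      (isOpen_isUnit_one_sub_mul p) hU, ?_⟩
  ext y
  constructor
  · rintro ⟨v, hv, rfl⟩
    refine ⟨c.cayley_mem v (hball v hv),
      isUnit_one_sub_mul_cayley c.mem_twistorSpace (c.skew v), ?_⟩
    simpa only [Set.mem_preimage, c.P_cayleyInv_cayley] using hv
  · rintro ⟨hy, hu, hv⟩
    exact ⟨_, hv, c.cayley_L_P_cayleyInv hy hu⟩

end CayleyChart

/-- A set with Cayley charts whose linear parametrisations are complex linear is a complex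
submanifold. -/
theorem isComplexSubmanifold_of_cayleyChart (hX : X ⊆ twistorSpace V)
    (h : ∀ p ∈ X, ∃ (k : ℕ) (c : CayleyChart X p (EuclideanSpace ℂ (Fin k))),
      ∀ v, c.L (Complex.I • v) = p * c.L v) : IsComplexSubmanifold X := by
  refine ⟨hX, fun p hp => ?_⟩
  obtain ⟨k, c, hc⟩ := h p hp
  refine ⟨k, {v | ‖c.L v‖ < c.radius}, fun v => cayley p (c.L v),
    isOpen_lt c.L.continuous.norm continuous_const, ⟨0, by simpa using c.radius_pos, ?_⟩,
    c.contDiff_param.contDiffOn, ?_, fun U' hU' hO => c.exists_isOpen_image_eq hO hU', ?_⟩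
  · simp [cayley_zero]
  · intro v _ w _ hvw
    have := congrArg (fun y => c.P (cayleyInv p y)) hvw
    simpa only [c.P_cayleyInv_cayley] using this
  · intro z _
    rw [(c.hasFDerivAt_param z).fderiv]
    refine ⟨?_, fun v => ?_⟩
    · rw [injective_iff_map_eq_zero]
      intro v hv
      have h0 : c.L v = 0 := by
        refine cayley_deriv_injective c.mem_twistorSpace (c.isUnit_one_add_L z) ?_
        simpa [mul_assoc] using hv
      rw [← c.left_inv v, h0, map_zero]
    · have := mul_cayley_deriv (c.skew z) (c.L v)
      simp only [ContinuousLinearMap.comp_apply, smul_apply, ContinuousLinearMap.mul_apply',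
        ContinuousLinearMap.mulLeftRight_apply, hc, almostComplex, mul_smul_comm]
      rw [this]

/-- The charted space structure given by a family of Cayley charts. -/
@[reducible]
def cayleyChartedSpace (c : ∀ p : X, CayleyChart X (p : V →L[ℝ] V) H) : ChartedSpace H X where
  atlas := Set.range fun p => (c p).chart
  chartAt p := (c p).chart
  mem_chart_source p := (c p).self_mem_chart_source
  chart_mem_atlas p := ⟨p, rfl⟩

theorem isManifold_cayleyChartedSpace (c : ∀ p : X, CayleyChart X (p : V →L[ℝ] V) H) :
    @IsManifold ℝ _ H _ _ H _ 𝓘(ℝ, H) ∞ X _ (cayleyChartedSpace c) := by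
  let := cayleyChartedSpace c
  refine isManifold_of_contDiffOn _ _ _ ?_
  rintro e e' ⟨p, rfl⟩ ⟨q, rfl⟩
  simp only [modelWithCornersSelf_coe, modelWithCornersSelf_coe_symm, Function.comp_id,
    Function.id_comp, Set.preimage_id, Set.range_id, Set.inter_univ]
  have hcongr : ∀ v ∈ ((c p).chart.symm.trans (c q).chart).source,
      ((c p).chart.symm.trans (c q).chart) v =
        (c q).P (cayleyInv q (cayley p ((c p).L v))) := by
    intro v hv
    rw [OpenPartialHomeomorph.trans_source] at hv
    rw [OpenPartialHomeomorph.coe_trans, Function.comp_apply, CayleyChart.chart_apply,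
      (c p).coe_chart_symm hv.1]
  refine ContDiffOn.congr (fun v hv => ContDiffAt.contDiffWithinAt ?_) hcongr
  rw [OpenPartialHomeomorph.trans_source] at hv
  have hu := ((c q).mem_chart_source.1 hv.2).1
  rw [(c p).coe_chart_symm hv.1] at hu
  have h := (contDiffAt_cayleyInv hu).comp v (c p).contDiff_param.contDiffAt
  exact (c q).P.contDiff.contDiffAt.comp v h

theorem hasMFDerivAt_subtype_val (c : ∀ p : X, CayleyChart X (p : V →L[ℝ] V) H) (p : X) :
    letI := cayleyChartedSpace c
    HasMFDerivAt 𝓘(ℝ, H) 𝓘(ℝ, V →L[ℝ] V) (Subtype.val : X → V →L[ℝ] V) p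
      ((-2 : ℝ) • (ContinuousLinearMap.mul ℝ (V →L[ℝ] V) p).comp (c p).L) := by
  let := cayleyChartedSpace c
  refine ⟨continuous_subtype_val.continuousAt, ?_⟩
  have h0 : extChartAt 𝓘(ℝ, H) p p = 0 := (c p).chart_self
  rw [h0]
  have h1 := (c p).hasFDerivAt_param 0
  have hev : writtenInExtChartAt 𝓘(ℝ, H) 𝓘(ℝ, V →L[ℝ] V) p (Subtype.val : X → V →L[ℝ] V)
      =ᶠ[nhds 0] fun v => cayley p ((c p).L v) := by
    have : (c p).chart.target ∈ nhds (0 : H) :=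
      (c p).chart.open_target.mem_nhds (by
        rw [CayleyChart.mem_chart_target, map_zero, norm_zero]; exact (c p).radius_pos)
    filter_upwards [this] with v hv
    exact (c p).coe_chart_symm hv
  refine HasFDerivAt.hasFDerivWithinAt (HasFDerivAt.congr_of_eventuallyEq ?_ hev)
  refine h1.congr_fderiv ?_
  ext1 v
  simp

theorem contMDiff_subtype_val (c : ∀ p : X, CayleyChart X (p : V →L[ℝ] V) H) :
    letI := cayleyChartedSpace c
    ContMDiff 𝓘(ℝ, H) 𝓘(ℝ, V →L[ℝ] V) ∞ (Subtype.val : X → V →L[ℝ] V) := by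
  let := cayleyChartedSpace c
  have := isManifold_cayleyChartedSpace c
  intro p
  rw [contMDiffAt_iff]
  refine ⟨continuous_subtype_val.continuousAt, ?_⟩
  have h0 : extChartAt 𝓘(ℝ, H) p p = 0 := (c p).chart_self
  rw [h0]
  refine ContDiffAt.contDiffWithinAt ((c p).contDiff_param.contDiffAt.congr_of_eventuallyEq ?_)
  have : (c p).chart.target ∈ nhds (0 : H) :=
    (c p).chart.open_target.mem_nhds (by
      rw [CayleyChart.mem_chart_target, map_zero, norm_zero]; exact (c p).radius_pos)
  filter_upwards [this] with v hv
  exact (c p).coe_chart_symm hv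

/-- A connected set with Cayley charts modelled on the spaces `D p` is an integral manifold. -/
theorem isConnectedIntegralManifold_of_cayleyChart {d : ℕ}
    {D : (V →L[ℝ] V) → Submodule ℝ (V →L[ℝ] V)} (hX : X ⊆ twistorSpace V) (hconn : IsConnected X)
    (c : ∀ p : X, CayleyChart X (p : V →L[ℝ] V) (EuclideanSpace ℝ (Fin d)))
    (hc : ∀ p, Set.range (c p).L = (D p : Set (V →L[ℝ] V)))
    (hD : ∀ p ∈ X, ∀ B ∈ D p, p * B ∈ D p) :
    IsConnectedIntegralManifold (twistorSpace V) D X := by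
  have : ProperSpace (V →L[ℝ] V) := FiniteDimensional.proper ℝ _
  refine ⟨hX, d, X, inferInstance, cayleyChartedSpace c, Subtype.val,
    isManifold_cayleyChartedSpace c, inferInstance, inferInstance,
    isConnected_iff_connectedSpace.1 hconn, contMDiff_subtype_val c, Subtype.val_injective,
    Subtype.range_val, fun p => ?_⟩
  have hp := (hX p.2).1
  let := cayleyChartedSpace c
  rw [(hasMFDerivAt_subtype_val c p).mfderiv]
  have happ : ∀ v, ((-2 : ℝ) • (ContinuousLinearMap.mul ℝ (V →L[ℝ] V) p).comp (c p).L) v =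
      (-2 : ℝ) • ((p : V →L[ℝ] V) * (c p).L v) := fun v => rfl
  constructor
  · refine (injective_iff_map_eq_zero
      ((-2 : ℝ) • (ContinuousLinearMap.mul ℝ (V →L[ℝ] V) p).comp (c p).L)).2 fun v hv => ?_
    rw [happ, smul_eq_zero_iff_right (by norm_num)] at hv
    have h0 : (c p).L v = 0 := by
      rw [← neg_eq_zero, ← neg_one_mul, ← hp, mul_assoc, hv, mul_zero]
    rw [← (c p).left_inv v, h0, map_zero]
  · refine Set.ext fun (B : V →L[ℝ] V) => ?_
    constructor
    · rintro ⟨v, rfl⟩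
      refine (D p).smul_mem (-2 : ℝ) (hD p p.2 _ ?_)
      rw [← SetLike.mem_coe, ← hc]
      exact ⟨v, rfl⟩
    · intro hB
      have hB' : (2⁻¹ : ℝ) • ((p : V →L[ℝ] V) * B) ∈ (D p : Set (V →L[ℝ] V)) :=
        (D p).smul_mem _ (hD p p.2 B hB)
      rw [← hc] at hB'
      obtain ⟨v, hv⟩ := hB'
      refine ⟨v, (happ v).trans ?_⟩
      rw [hv, mul_smul_comm, ← mul_assoc, hp, smul_smul]
      norm_num

end CayleyAtlas

end

end Twistor

namespace Twistor

noncomputable section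

section Parametrisation

variable {E : Type*} [NormedAddCommGroup E] [NormedSpace ℝ E] [FiniteDimensional ℝ E]

/-- A linear parametrisation of a subspace extends to one with a continuous left inverse. -/
theorem exists_leftInverse_param {H : Type*} [NormedAddCommGroup H] [NormedSpace ℝ H]
    [FiniteDimensional ℝ H] {D : Submodule ℝ E} (e : H ≃ₗ[ℝ] D) :
    ∃ (L : H →L[ℝ] E) (P : E →L[ℝ] H), (∀ v, P (L v) = v) ∧ (∀ v, L v = e v) ∧
      Set.range L = (D : Set E) := by
  obtain ⟨P, hP⟩ := LinearMap.exists_leftInverse_of_injective (D.subtype.comp e.toLinearMap)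
    (LinearMap.ker_eq_bot.2 (D.injective_subtype.comp e.injective))
  refine ⟨LinearMap.toContinuousLinearMap (D.subtype.comp e.toLinearMap),
    LinearMap.toContinuousLinearMap P, fun v => ?_, fun v => rfl, ?_⟩
  · exact LinearMap.congr_fun hP v
  · ext x
    constructor
    · rintro ⟨v, rfl⟩
      exact (e v).2
    · intro hx
      exact ⟨e.symm ⟨x, hx⟩, by simp⟩

/-- A real vector space with a complex structure `j` is isomorphic to some `ℂ^k`. -/
theorem exists_complex_equiv {D : Type*} [AddCommGroup D] [Module ℝ D] [Module.Finite ℝ D]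
    (j : Module.End ℝ D) (hj : j * j = -1) :
    ∃ (k : ℕ) (e : EuclideanSpace ℂ (Fin k) ≃ₗ[ℝ] D), ∀ v, e (Complex.I • v) = j (e v) := by
  let φ : ℂ →ₐ[ℝ] Module.End ℝ D := Complex.lift ⟨j, hj⟩
  let _ : Module ℂ D := Module.compHom D φ.toRingHom
  have hsmul : ∀ (z : ℂ) (x : D), z • x = φ z x := fun _ _ => rfl
  have : IsScalarTower ℝ ℂ D := ⟨fun r z x => by simp [hsmul]⟩
  have : Module.Finite ℂ D := Module.Finite.of_restrictScalars_finite ℝ ℂ D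
  refine ⟨Module.finrank ℂ D, (((Module.finBasis ℂ D).equivFun.trans
    (WithLp.linearEquiv 2 ℂ _).symm).symm).restrictScalars ℝ, fun v => ?_⟩
  rw [LinearEquiv.restrictScalars_apply, map_smul, hsmul]
  simp [φ]

end Parametrisation

section Component

variable {V : Type u} [NormedAddCommGroup V] [InnerProductSpace ℝ V] [FiniteDimensional ℝ V]

theorem isUnit_one_sub_mul_comm {p x : V →L[ℝ] V} (hp : p ∈ twistorSpace V)
    (hx : x ∈ twistorSpace V) (hu : IsUnit (1 - p * x)) : IsUnit (1 - x * p) := by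
  have h : star (1 - p * x) = 1 - x * p := by
    simp [star_mul, (mem_twistorSpace_iff.1 hp).2, (mem_twistorSpace_iff.1 hx).2]
  rw [← h]
  exact hu.star

theorem eq_zero_of_isUnit_apply {C : V →L[ℝ] V} (hC : IsUnit C) {v : V} (h : C v = 0) : v = 0 := by
  obtain ⟨u, rfl⟩ := hC
  have h1 : ((u⁻¹ : (V →L[ℝ] V)ˣ) : V →L[ℝ] V) ((u : V →L[ℝ] V) v) = v := by
    rw [← mul_apply_eq_comp, u.inv_mul]; rfl
  rw [← h1, h, map_zero]

theorem finrank_skewAntiOn_le {M : Submodule ℝ V} {p x : V →L[ℝ] V} (hp : p ∈ twistorSpace V)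
    (hx : x ∈ twistorSpace V) (hpM : ∀ v ∈ M, p v ∈ M) (hxM : ∀ v ∈ M, x v ∈ M)
    (hu : IsUnit (1 - x * p)) :
    Module.finrank ℝ (skewAntiOn M p) ≤ Module.finrank ℝ (skewAntiOn M x) := by
  have hs : star (1 - x * p) = 1 - p * x := by
    simp [star_mul, (mem_twistorSpace_iff.1 hp).2, (mem_twistorSpace_iff.1 hx).2]
  refine LinearMap.finrank_le_finrank_of_injective
    (conjSkewAntiOn_injective (C := 1 - x * p) (N := M) hp hx ?_ ?_
      fun w _ hw => eq_zero_of_isUnit_apply hu hw)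
  · rw [sub_mul, mul_sub, mul_assoc, hp.1, ← mul_assoc, hx.1]
    noncomm_ring
  · intro v hv
    rw [hs]
    exact M.sub_mem hv (hpM _ (hxM v hv))

variable {J : V →L[ℝ] V} {F : (V →L[ℝ] V) → (V →L[ℝ] V)} {K : V →L[ℝ] V}

theorem component_subset_twistorSpace
    (hF : ∀ y ∈ twistorSpace V, FieldRelations J y (F y)) (hK : K ∈ twistorSpace V) :
    connectedComponentIn (leafSet F K) K ⊆ twistorSpace V := fun _ hx =>
  mem_twistorSpace_of_mem_leafSet hK (hF K hK) (connectedComponentIn_subset _ _ hx)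

theorem finrank_distribution_eq_of_isUnit
    (hF : ∀ y ∈ twistorSpace V, FieldRelations J y (F y)) {p x : V →L[ℝ] V}
    (hp : p ∈ twistorSpace V) (hx : x ∈ leafSet F p) (hu : IsUnit (1 - p * x)) :
    Module.finrank ℝ (distribution F x) = Module.finrank ℝ (distribution F p) := by
  obtain ⟨hx1, -, hx3⟩ := (mem_leafSet_iff hF hp).1 hx
  have hpM : ∀ v ∈ (F p).ker, p v ∈ (F p).ker := fun v hv => (hF p hp).apply_self_eq_zero hv
  have hxM : ∀ v ∈ (F p).ker, x v ∈ (F p).ker := by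
    rw [← hx3]
    exact fun v hv => (hF x hx1).apply_self_eq_zero hv
  rw [distribution_eq_skewAntiOn (hF x hx1), distribution_eq_skewAntiOn (hF p hp), hx3]
  exact le_antisymm (finrank_skewAntiOn_le hx1 hp hxM hpM hu)
    (finrank_skewAntiOn_le hp hx1 hpM hxM (isUnit_one_sub_mul_comm hp hx1 hu))

theorem finrank_distribution_component
    (hF : ∀ y ∈ twistorSpace V, FieldRelations J y (F y)) (hK : K ∈ twistorSpace V)
    {p : V →L[ℝ] V} (hp : p ∈ connectedComponentIn (leafSet F K) K) :
    Module.finrank ℝ (distribution F p) = Module.finrank ℝ (distribution F K) := by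
  have hKX : K ∈ connectedComponentIn (leafSet F K) K :=
    mem_connectedComponentIn (self_mem_leafSet hF hK)
  have hpre : PreconnectedSpace (connectedComponentIn (leafSet F K) K) :=
    isPreconnected_iff_preconnectedSpace.1 isPreconnected_connectedComponentIn
  have hlc : IsLocallyConstant fun x : connectedComponentIn (leafSet F K) K =>
      Module.finrank ℝ (distribution F x) := by
    rw [IsLocallyConstant.iff_eventually_eq]
    intro x
    have hxT := component_subset_twistorSpace hF hK x.2
    have hopen := (isOpen_isUnit_one_sub_mul (x : V →L[ℝ] V)).preimage
      (continuous_subtype_val (p := (· ∈ connectedComponentIn (leafSet F K) K)))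
    have hx : IsUnit (1 - (x : V →L[ℝ] V) * x) := by
      have := isUnit_one_sub_mul_cayley hxT (A := 0) (Submodule.zero_mem _)
      rwa [cayley_zero] at this
    filter_upwards [hopen.mem_nhds hx] with y hy
    refine finrank_distribution_eq_of_isUnit hF hxT ?_ hy
    rw [leafSet_eq_of_mem hF hK (connectedComponentIn_subset _ _ x.2)]
    exact connectedComponentIn_subset _ _ y.2
  exact hlc.apply_eq_of_preconnectedSpace ⟨p, hp⟩ ⟨K, hKX⟩

/-- The Cayley charts of the component of the leaf set. -/
theorem exists_cayleyChart_component
    (hF : ∀ y ∈ twistorSpace V, FieldRelations J y (F y)) (hK : K ∈ twistorSpace V)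
    (hball : ∀ p ∈ twistorSpace V, ∃ ε > 0, ∀ A ∈ distribution F p, ‖A‖ < ε →
      cayley p A ∈ leafSet F p)
    {p : V →L[ℝ] V} (hp : p ∈ connectedComponentIn (leafSet F K) K)
    {H : Type*} [NormedAddCommGroup H] [NormedSpace ℝ H] [FiniteDimensional ℝ H]
    (e : H ≃ₗ[ℝ] distribution F p) :
    ∃ c : CayleyChart (connectedComponentIn (leafSet F K) K) p H,
      (∀ v, c.L v = e v) ∧ Set.range c.L = (distribution F p : Set (V →L[ℝ] V)) := by
  have hpT := component_subset_twistorSpace hF hK hp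
  have hleaf : leafSet F p = leafSet F K :=
    leafSet_eq_of_mem hF hK (connectedComponentIn_subset _ _ hp)
  obtain ⟨ε, hε, hεmem⟩ := hball p hpT
  obtain ⟨L, P, h1, h2, h3⟩ := exists_leftInverse_param e
  have hL : ∀ v, L v ∈ distribution F p := fun v => by rw [h2]; exact (e v).2
  refine ⟨⟨ε, L, P, hp, hpT, hε, h1, fun v => (hL v).1, ?_, ?_⟩, h2, h3⟩
  · have hsub : (fun v => cayley p (L v)) '' (L ⁻¹' Metric.ball 0 ε) ⊆ leafSet F K := by
      rintro _ ⟨v, hv, rfl⟩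
      rw [← hleaf]
      exact hεmem _ (hL v) (by simpa using hv)
    have hpre : IsPreconnected ((fun v => cayley p (L v)) '' (L ⁻¹' Metric.ball 0 ε)) := by
      have hconv : Convex ℝ (L ⁻¹' Metric.ball 0 ε) :=
        (convex_ball (0 : V →L[ℝ] V) ε).linear_preimage L.toLinearMap
      refine hconv.isPreconnected.image _ fun v _ => ?_
      · have hu := isUnit_one_add (mem_skewAnti_iff.1 (hL v).1).1
        have hc := (contDiffAt_cayley (p := p) hu).continuousAt
        have hc' := hc.comp L.continuous.continuousAt
        exact hc'.continuousWithinAt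
    have hpmem : p ∈ (fun v => cayley p (L v)) '' (L ⁻¹' Metric.ball 0 ε) :=
      ⟨0, by simpa using hε, by simp [cayley_zero]⟩
    intro v hv
    rw [connectedComponentIn_eq hp]
    exact hpre.subset_connectedComponentIn hpmem hsub ⟨v, by simpa using hv, rfl⟩
  · intro x hx hu
    have hx' : x ∈ leafSet F p := hleaf ▸ connectedComponentIn_subset _ _ hx
    obtain ⟨hx1, hx2, -⟩ := (mem_leafSet_iff hF hpT).1 hx'
    have hmem := cayleyInv_mem hpT hx1 hx2 hu
    rw [← distribution_eq_skewAntiOn (hF p hpT), ← SetLike.mem_coe, ← h3] at hmem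
    exact hmem

theorem mul_mem_distribution (hF : ∀ y ∈ twistorSpace V, FieldRelations J y (F y))
    {p : V →L[ℝ] V} (hp : p ∈ twistorSpace V) {B : V →L[ℝ] V} (hB : B ∈ distribution F p) :
    p * B ∈ distribution F p := by
  rw [distribution_eq_skewAntiOn (hF p hp)] at hB ⊢
  exact mul_mem_skewAntiOn hp hB

theorem isConnectedIntegralManifold_component
    (hF : ∀ y ∈ twistorSpace V, FieldRelations J y (F y)) (hK : K ∈ twistorSpace V)
    (hball : ∀ p ∈ twistorSpace V, ∃ ε > 0, ∀ A ∈ distribution F p, ‖A‖ < ε →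
      cayley p A ∈ leafSet F p) :
    IsConnectedIntegralManifold (twistorSpace V) (distribution F)
      (connectedComponentIn (leafSet F K) K) := by
  have hchart : ∀ p : connectedComponentIn (leafSet F K) K,
      ∃ c : CayleyChart (connectedComponentIn (leafSet F K) K) (p : V →L[ℝ] V)
        (EuclideanSpace ℝ (Fin (Module.finrank ℝ (distribution F K)))),
        Set.range c.L = (distribution F p : Set (V →L[ℝ] V)) := by
    intro p
    have hfin : Module.finrank ℝ (EuclideanSpace ℝ (Fin (Module.finrank ℝ (distribution F K)))) =
        Module.finrank ℝ (distribution F p) := by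
      rw [finrank_euclideanSpace_fin, finrank_distribution_component hF hK p.2]
    obtain ⟨c, -, hc⟩ := exists_cayleyChart_component hF hK hball p.2
      (LinearEquiv.ofFinrankEq _ _ hfin)
    exact ⟨c, hc⟩
  choose c hc using hchart
  have hsub := component_subset_twistorSpace hF hK
  exact isConnectedIntegralManifold_of_cayleyChart hsub
    (isConnected_connectedComponentIn_iff.2 (self_mem_leafSet hF hK)) c hc
    fun p hp B hB => mul_mem_distribution hF (hsub hp) hB

theorem isComplexSubmanifold_component
    (hF : ∀ y ∈ twistorSpace V, FieldRelations J y (F y)) (hK : K ∈ twistorSpace V)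
    (hball : ∀ p ∈ twistorSpace V, ∃ ε > 0, ∀ A ∈ distribution F p, ‖A‖ < ε →
      cayley p A ∈ leafSet F p) :
    IsComplexSubmanifold (connectedComponentIn (leafSet F K) K) := by
  refine isComplexSubmanifold_of_cayleyChart (component_subset_twistorSpace hF hK) fun p hp => ?_
  have hpT := component_subset_twistorSpace hF hK hp
  let j : Module.End ℝ (distribution F p) :=
    ((LinearMap.mulLeft ℝ p).comp (distribution F p).subtype).codRestrict (distribution F p)
      fun B => mul_mem_distribution hF hpT B.2
  have hj : j * j = -1 := by
    refine LinearMap.ext fun B => Subtype.ext ?_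
    change p * (p * (B : V →L[ℝ] V)) = -B
    rw [← mul_assoc, hpT.1, neg_one_mul]
  obtain ⟨k, e, he⟩ := exists_complex_equiv j hj
  obtain ⟨c, hc, -⟩ := exists_cayleyChart_component hF hK hball hp e
  refine ⟨k, c, fun v => ?_⟩
  rw [hc, hc, he]
  rfl

end Component

end

end Twistor

namespace Twistor

noncomputable section

section Maximality

variable {V : Type u} [NormedAddCommGroup V] [InnerProductSpace ℝ V] [FiniteDimensional ℝ V]

/-- An intertwiner of `p` and `x` that is injective on the image of `G p`. -/
def leafIntertwiner (G : (V →L[ℝ] V) → (V →L[ℝ] V)) (p x : V →L[ℝ] V) : V →L[ℝ] V :=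
  G x * G x * (1 - x * p)

variable {J : V →L[ℝ] V} {G : (V →L[ℝ] V) → (V →L[ℝ] V)} {p x : V →L[ℝ] V}

theorem leafIntertwiner_mul (hG : FieldRelations J x (G x)) (hp : p ∈ twistorSpace V)
    (hx : x ∈ twistorSpace V) : leafIntertwiner G p x * p = x * leafIntertwiner G p x := by
  have h : (1 - x * p) * p = x * (1 - x * p) := by
    rw [sub_mul, mul_sub, mul_assoc, hp.1, ← mul_assoc, hx.1]
    noncomm_ring
  rw [leafIntertwiner, mul_assoc, h, ← mul_assoc, hG.sq_comm, mul_assoc]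

theorem star_leafIntertwiner (hG : FieldRelations J x (G x)) (hp : p ∈ twistorSpace V)
    (hx : x ∈ twistorSpace V) : star (leafIntertwiner G p x) = (1 - p * x) * (G x * G x) := by
  have h1 : star (1 - x * p) = 1 - p * x := by
    simp [star_mul, (mem_twistorSpace_iff.1 hp).2, (mem_twistorSpace_iff.1 hx).2]
  have h2 : star (G x * G x) = G x * G x := by
    rw [star_mul]
    rcases hG.star_eq with h | h <;> rw [h]
    rw [neg_mul_neg]
  rw [leafIntertwiner, star_mul, h1, h2]

/-- If the distribution has the same nonzero dimension at `p` and `x`, then every vector is the sum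
of an element of the kernel at `x` and the image of a vector in the image of `G p`. -/
theorem exists_leafIntertwiner_decomposition (hGp : FieldRelations J p (G p))
    (hGx : FieldRelations J x (G x)) (hp : p ∈ twistorSpace V) (hx : x ∈ twistorSpace V)
    (hinj : ∀ w ∈ (G p).kerᗮ, G x (leafIntertwiner G p x w) = 0 → w = 0)
    (hfin : Module.finrank ℝ (distribution G x) = Module.finrank ℝ (distribution G p))
    (hne : Module.finrank ℝ (distribution G x) ≠ 0) (v : V) :
    ∃ w ∈ (G p).kerᗮ, ∃ z ∈ (G x).ker, v = leafIntertwiner G p x w + z := by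
  rw [distribution_eq_skewAntiOn hGx, distribution_eq_skewAntiOn hGp] at hfin
  rw [distribution_eq_skewAntiOn hGx] at hne
  have hstar := star_leafIntertwiner hGx hp hx
  have hN : ∀ v ∈ (G x).ker, star (leafIntertwiner G p x) v ∈ (G p).ker := by
    intro v hv
    have hv' : G x v = 0 := hv
    simp [hstar, hv']
  have hC := leafIntertwiner_mul hGx hp hx
  have hcinj := conjSkewAntiOn_injective hp hx hC hN
    fun w hw h => hinj w hw (by rw [h, map_zero])
  have hsurj := (LinearMap.injective_iff_surjective_of_finrank_eq_finrank hfin.symm).1 hcinj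
  obtain ⟨y, hy, z, hz, rfl⟩ := Submodule.exists_add_mem_mem_orthogonal
    (K := (G p).kerᗮ.map (leafIntertwiner G p x : V →ₗ[ℝ] V)) v
  obtain ⟨w, hw, rfl⟩ := hy
  refine ⟨w, hw, z, ?_, rfl⟩
  obtain ⟨⟨B₀, hB₀⟩, hB₀ne⟩ : ∃ B : skewAntiOn (G x).ker x, B ≠ 0 := by
    by_contra! h
    have : Subsingleton (skewAntiOn (G x).ker x) := ⟨fun a b => by rw [h a, h b]⟩
    exact hne (Module.finrank_zero_of_subsingleton)
  refine mem_of_forall_skewAntiOn_apply_eq_zero hx (fun v hv => hGx.apply_self_eq_zero hv) hB₀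
    (fun h => hB₀ne (Subtype.ext h)) fun B hB => ?_
  obtain ⟨⟨B', hB'⟩, hBB'⟩ := hsurj ⟨B, hB⟩
  have hB'' : B = leafIntertwiner G p x * B' * star (leafIntertwiner G p x) :=
    (congrArg Subtype.val hBB').symm
  have hzM : star (leafIntertwiner G p x) z ∈ (G p).ker := by
    rw [← Submodule.orthogonal_orthogonal (G p).ker, Submodule.mem_orthogonal']
    intro w' hw'
    rw [ContinuousLinearMap.star_eq_adjoint, ContinuousLinearMap.adjoint_inner_left]
    exact Submodule.inner_left_of_mem_orthogonal (Submodule.mem_map_of_mem hw') hz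
  rw [hB'', mul_apply_eq_comp, mul_apply_eq_comp, hB'.2 _ hzM, map_zero]

/-- Along a curve tangent to the distribution of `G`, vectors in the kernel at the starting point
stay in the kernel. -/
theorem apply_eq_zero_along_curve (hGd : ContDiff ℝ ∞ G)
    (hrel : ∀ y ∈ twistorSpace V, FieldRelations J y (G y))
    (hGder : ∀ y ∈ twistorSpace V, ∀ B : V →L[ℝ] V, (∀ v ∈ (G y).ker, B v = 0) →
      ∀ v ∈ (G y).ker, fderiv ℝ G y B v = 0)
    {γ γ' : ℝ → V →L[ℝ] V}
    (hγ : ∀ t ∈ Set.Icc (0 : ℝ) 1, HasDerivWithinAt γ (γ' t) (Set.Icc 0 1) t)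
    (hγ' : ContinuousOn γ' (Set.Icc 0 1))
    (hγT : ∀ t ∈ Set.Icc (0 : ℝ) 1, γ t ∈ twistorSpace V)
    (hγD : ∀ t ∈ Set.Icc (0 : ℝ) 1, γ' t ∈ distribution G (γ t))
    (hfin : ∀ t ∈ Set.Icc (0 : ℝ) 1,
      Module.finrank ℝ (distribution G (γ t)) = Module.finrank ℝ (distribution G (γ 0)))
    (hne : Module.finrank ℝ (distribution G (γ 0)) ≠ 0)
    {δ : ℝ} (hδ : 0 < δ) (hlow : ∀ t ∈ Set.Icc (0 : ℝ) 1, ∀ w ∈ (G (γ 0)).kerᗮ,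
      δ * ‖w‖ ≤ ‖G (γ t) (leafIntertwiner G (γ 0) (γ t) w)‖)
    {v : V} (hv : G (γ 0) v = 0) : ∀ t ∈ Set.Icc (0 : ℝ) 1, G (γ t) v = 0 := by
  have h0 : (0 : ℝ) ∈ Set.Icc (0 : ℝ) 1 := ⟨le_rfl, zero_le_one⟩
  have hγc : ContinuousOn γ (Set.Icc 0 1) := fun t ht => (hγ t ht).continuousWithinAt
  have hGγc : ContinuousOn (fun t => G (γ t)) (Set.Icc 0 1) :=
    hGd.continuous.comp_continuousOn hγc
  have hdc : ContinuousOn (fun t => fderiv ℝ G (γ t) (γ' t)) (Set.Icc 0 1) :=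
    ((hGd.continuous_fderiv (by simp)).comp_continuousOn hγc).clm_apply hγ'
  have hCc : ContinuousOn (fun t => leafIntertwiner G (γ 0) (γ t)) (Set.Icc 0 1) :=
    (hGγc.mul hGγc).mul (continuousOn_const.sub (hγc.mul continuousOn_const))
  obtain ⟨b, hb⟩ := isCompact_Icc.exists_bound_of_continuousOn (hdc.mul hCc)
  have hder : ∀ t ∈ Set.Icc (0 : ℝ) 1, HasDerivWithinAt (fun s => G (γ s) v)
      (fderiv ℝ G (γ t) (γ' t) v) (Set.Icc 0 1) t := by
    intro t ht
    have h1 : HasFDerivAt G (fderiv ℝ G (γ t)) (γ t) :=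
      (hGd.differentiable (by simp) (γ t)).hasFDerivAt
    have h2 : HasDerivWithinAt (fun s => G (γ s)) (fderiv ℝ G (γ t) (γ' t)) (Set.Icc 0 1) t :=
      h1.comp_hasDerivWithinAt t (hγ t ht)
    simpa using h2.clm_apply (hasDerivWithinAt_const t (Set.Icc (0 : ℝ) 1) v)
  refine eq_zero_of_abs_deriv_le_mul_abs_self_of_eq_zero_right (K := b / δ)
    (f' := fun t => fderiv ℝ G (γ t) (γ' t) v)
    (fun t ht => (hder t ht).continuousWithinAt) ?_ hv ?_
  · intro t ht
    exact (hder t ⟨ht.1, ht.2.le⟩).mono_of_mem_nhdsWithin (Icc_mem_nhdsGE_of_mem ht)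
  · intro t ht'
    have ht : t ∈ Set.Icc (0 : ℝ) 1 := ⟨ht'.1, ht'.2.le⟩
    have hlt := hlow t ht
    obtain ⟨w, hw, z, hz, hvz⟩ := exists_leafIntertwiner_decomposition (hrel _ (hγT 0 h0))
      (hrel _ (hγT t ht)) (hγT 0 h0) (hγT t ht)
      (fun w hw h => by
        have := hlt w hw
        rw [h, norm_zero] at this
        exact norm_eq_zero.1 (le_antisymm (nonpos_of_mul_nonpos_right this hδ) (norm_nonneg _)))
      (hfin t ht) (by rw [hfin t ht]; exact hne) v
    have hz' : G (γ t) z = 0 := hz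
    have hz'' : fderiv ℝ G (γ t) (γ' t) z = 0 :=
      hGder _ (hγT t ht) _ (fun y hy => (hγD t ht).2.1 y hy) z hz
    have hbt := hb t ht
    have hb0 : 0 ≤ b := (norm_nonneg _).trans hbt
    have e1 : G (γ t) v = G (γ t) (leafIntertwiner G (γ 0) (γ t) w) := by
      rw [hvz, map_add, hz', add_zero]
    have e2 : fderiv ℝ G (γ t) (γ' t) v =
        (fderiv ℝ G (γ t) (γ' t) * leafIntertwiner G (γ 0) (γ t)) w := by
      rw [hvz, map_add, hz'', add_zero]; rfl
    rw [e1, e2]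
    calc ‖(fderiv ℝ G (γ t) (γ' t) * leafIntertwiner G (γ 0) (γ t)) w‖ ≤ b * ‖w‖ :=
          (ContinuousLinearMap.le_opNorm _ w).trans (by gcongr; exact hbt)
      _ = b / δ * (δ * ‖w‖) := by field_simp
      _ ≤ _ := by gcongr; exact hlt w hw

variable {S : (V →L[ℝ] V) → (V →L[ℝ] V)} {k : ℕ} {a : Fin (k + 1) → (V →L[ℝ] V) → ℝ}

theorem distribution_congr {F F' : (V →L[ℝ] V) → (V →L[ℝ] V)} {x : V →L[ℝ] V} (h : F x = F' x) :
    distribution F x = distribution F' x := by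
  ext B
  simp only [distribution, Submodule.mem_mk, AddSubmonoid.mem_mk, AddSubsemigroup.mem_mk, h]

/-- The endpoint of a short curve tangent to the distribution lies in the leaf set of its starting
point. -/
theorem mem_leafSet_of_curve (hJ : J ∈ twistorSpace V) (hS : S ∈ admissibleS J)
    (ha : ∀ i, ContDiffOn ℝ ∞ (a i) (twistorSpace V))
    (hint : ∀ i, ∀ L ∈ twistorSpace V, ∀ B ∈ distribution S L,
      fderivWithin ℝ (a i) (twistorSpace V) L B = 0)
    {c : Fin (k + 1) → ℝ} {γ γ' : ℝ → V →L[ℝ] V} (hc : ∀ i, a i (γ 0) = c i)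
    (hγ : ∀ t ∈ Set.Icc (0 : ℝ) 1, HasDerivWithinAt γ (γ' t) (Set.Icc 0 1) t)
    (hγ' : ContinuousOn γ' (Set.Icc 0 1))
    (hγT : ∀ t ∈ Set.Icc (0 : ℝ) 1, γ t ∈ twistorSpace V)
    (hγD : ∀ t ∈ Set.Icc (0 : ℝ) 1, γ' t ∈ distribution (leafField J a S) (γ t))
    (hfin : ∀ t ∈ Set.Icc (0 : ℝ) 1, Module.finrank ℝ (distribution (leafField J a S) (γ t)) =
      Module.finrank ℝ (distribution (leafField J a S) (γ 0)))
    {δ : ℝ} (hδ : 0 < δ)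
    (hlow : ∀ t ∈ Set.Icc (0 : ℝ) 1, ∀ w ∈ (constField J c S (γ 0)).kerᗮ, δ * ‖w‖ ≤
      ‖constField J c S (γ t) (leafIntertwiner (constField J c S) (γ 0) (γ t) w)‖)
    (hlow' : ∀ w ∈ (constField J c S (γ 0)).kerᗮ, constField J c S (γ 1) w = 0 → w = 0) :
    γ 1 ∈ leafSet (leafField J a S) (γ 0) := by
  have h0 : (0 : ℝ) ∈ Set.Icc (0 : ℝ) 1 := ⟨le_rfl, zero_le_one⟩
  have h1 : (1 : ℝ) ∈ Set.Icc (0 : ℝ) 1 := ⟨zero_le_one, le_rfl⟩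
  have hrel := leafField_relations hJ hS a
  by_cases hne : Module.finrank ℝ (distribution (leafField J a S) (γ 0)) = 0
  · have hconst := constant_of_derivWithin_zero (f := γ) (a := 0) (b := 1)
      (fun t ht => (hγ t ht).differentiableWithinAt) (fun t ht => by
        have ht' : t ∈ Set.Icc (0 : ℝ) 1 := ⟨ht.1, ht.2.le⟩
        rw [(hγ t ht').derivWithin (uniqueDiffOn_Icc one_pos t ht')]
        have hD := hγD t ht'
        rwa [Submodule.finrank_eq_zero.1 ((hfin t ht').trans hne), Submodule.mem_bot] at hD) 1 h1
    rw [hconst]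
    exact self_mem_leafSet hrel (hγT 0 h0)
  have hcoef : ∀ t ∈ Set.Icc (0 : ℝ) 1, leafField J a S (γ t) = constField J c S (γ t) := by
    intro t ht
    refine leafField_eq_constField fun i => ?_
    rw [← hc i]
    exact coefficient_eq_of_tangent (ha i) (hint i) hγ hγT
      (fun s hs => distribution_leafField_le hJ hS a (hγT s hs) (hγD s hs)) t ht
  have hdist : ∀ t ∈ Set.Icc (0 : ℝ) 1, distribution (leafField J a S) (γ t) =
      distribution (constField J c S) (γ t) := fun t ht => distribution_congr (hcoef t ht)
  have hzero : ∀ t ∈ Set.Icc (0 : ℝ) 1, ∀ v, constField J c S (γ 0) v = 0 →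
      constField J c S (γ t) v = 0 := fun t ht v hv =>
    apply_eq_zero_along_curve (contDiff_constField hS c)
      (leafField_relations hJ hS fun i _ => c i)
      (fun y hy B hB => fderiv_constField_apply_eq_zero hJ hS c hy hB) hγ hγ' hγT
      (fun s hs => hdist s hs ▸ hγD s hs)
      (fun s hs => by rw [← hdist s hs, ← hdist 0 h0, hfin s hs])
      (by rwa [← hdist 0 h0]) hδ hlow hv t ht
  rw [mem_leafSet_iff hrel (hγT 0 h0), hcoef 0 h0, hcoef 1 h1]
  refine ⟨hγT 1 h1, fun v hv => ?_, le_antisymm (fun v hv => ?_) fun v hv => hzero 1 h1 v hv⟩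
  · have hd : ∀ t ∈ Set.Icc (0 : ℝ) 1, HasDerivWithinAt (fun s => γ s v) 0 (Set.Icc 0 1) t := by
      intro t ht
      have h2 : HasDerivWithinAt (fun s => γ s v) (γ' t v) (Set.Icc 0 1) t := by
        simpa using (hγ t ht).clm_apply (hasDerivWithinAt_const t (Set.Icc (0 : ℝ) 1) v)
      have h3 : γ' t v = 0 := (hγD t ht).2.1 v (by rw [hcoef t ht]; exact hzero t ht v hv)
      rwa [h3] at h2
    exact constant_of_derivWithin_zero (fun t ht => (hd t ht).differentiableWithinAt)
      (fun t ht => (hd t ⟨ht.1, ht.2.le⟩).derivWithin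
        (uniqueDiffOn_Icc one_pos t ⟨ht.1, ht.2.le⟩)) 1 h1
  · obtain ⟨m, hm, w, hw, rfl⟩ :=
      Submodule.exists_add_mem_mem_orthogonal (K := (constField J c S (γ 0)).ker) v
    have hv' : constField J c S (γ 1) (m + w) = 0 := hv
    rw [map_add, hzero 1 h1 m hm, zero_add] at hv'
    rw [hlow' w hw hv', add_zero]
    exact hm

/-- A parametrised integral manifold stays in the leaf set of a point near that point. -/
theorem eventually_mem_leafSet (hJ : J ∈ twistorSpace V) (hS : S ∈ admissibleS J)
    (ha : ∀ i, ContDiffOn ℝ ∞ (a i) (twistorSpace V))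
    (hint : ∀ i, ∀ L ∈ twistorSpace V, ∀ B ∈ distribution S L,
      fderivWithin ℝ (a i) (twistorSpace V) L B = 0)
    {H : Type*} [NormedAddCommGroup H] [NormedSpace ℝ H] {Ω : Set H} (hΩ : IsOpen Ω)
    {h : H → V →L[ℝ] V} (hh : ContDiffOn ℝ ∞ h Ω) (hT : ∀ u ∈ Ω, h u ∈ twistorSpace V)
    (hD : ∀ u ∈ Ω, ∀ w, fderiv ℝ h u w ∈ distribution (leafField J a S) (h u)) {d : ℕ}
    (hfin : ∀ u ∈ Ω, Module.finrank ℝ (distribution (leafField J a S) (h u)) = d)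
    {u₀ : H} (hu₀ : u₀ ∈ Ω) :
    ∀ᶠ u in nhds u₀, h u ∈ leafSet (leafField J a S) (h u₀) := by
  obtain ⟨c, hc⟩ : ∃ c : Fin (k + 1) → ℝ, ∀ i, a i (h u₀) = c i := ⟨_, fun _ => rfl⟩
  obtain ⟨G, hG⟩ : ∃ G, G = constField J c S := ⟨_, rfl⟩
  have hGc : Continuous G := by rw [hG]; exact (contDiff_constField hS c).continuous
  have hL := hT u₀ hu₀
  have hrel : FieldRelations J (h u₀) (G (h u₀)) := by
    rw [hG]; exact leafField_relations hJ hS _ _ hL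
  have hhc : ContinuousAt h u₀ := (hh.continuousOn.continuousAt (hΩ.mem_nhds hu₀))
  have hGh : ContinuousAt (fun u => G (h u)) u₀ := ContinuousAt.comp hGc.continuousAt hhc
  have hCc : ContinuousAt (fun u => G (h u) * leafIntertwiner G (h u₀) (h u)) u₀ :=
    hGh.mul ((hGh.mul hGh).mul (continuousAt_const.sub (hhc.mul continuousAt_const)))
  have hinj : ∀ w ∈ (G (h u₀)).kerᗮ, G (h u₀) w = 0 → w = 0 :=
    fun w hw h0 => hrel.eq_zero_of_mem_orthogonal hw h0
  have hGmem : ∀ w, G (h u₀) w ∈ (G (h u₀)).kerᗮ := fun w => by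
    rw [hrel.orthogonal_ker]; exact ⟨w, rfl⟩
  have hinj3 : ∀ w ∈ (G (h u₀)).kerᗮ,
      (G (h u₀) * leafIntertwiner G (h u₀) (h u₀)) w = 0 → w = 0 := by
    intro w hw h0
    have e : (G (h u₀) * leafIntertwiner G (h u₀) (h u₀)) w =
        G (h u₀) (G (h u₀) (G (h u₀) ((2 : ℝ) • w))) := by
      simp only [leafIntertwiner, hL.1, mul_apply_eq_comp, sub_neg_eq_add, add_apply,
        one_apply_eq_self, two_smul]
    rw [e] at h0
    have h3 := hinj _ (Submodule.smul_mem _ (2 : ℝ) hw)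
      (hinj _ (hGmem _) (hinj _ (hGmem _) h0))
    exact (smul_eq_zero_iff_right two_ne_zero).1 h3
  obtain ⟨δ, hδ, hev⟩ := exists_eventually_le_norm_apply _ _ hinj3
  obtain ⟨δ', hδ', hev'⟩ := exists_eventually_le_norm_apply _ _ hinj
  have hall := (hCc.eventually hev).and ((hGh.eventually hev').and (hΩ.mem_nhds hu₀))
  obtain ⟨r, hr, hball⟩ := Metric.eventually_nhds_iff_ball.1 hall
  filter_upwards [Metric.ball_mem_nhds u₀ hr] with u hu
  have hseg : ∀ t ∈ Set.Icc (0 : ℝ) 1, u₀ + t • (u - u₀) ∈ Metric.ball u₀ r := by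
    intro t ht
    rw [mem_ball_iff_norm, add_sub_cancel_left, norm_smul, Real.norm_of_nonneg ht.1]
    exact (mul_le_of_le_one_left (norm_nonneg _) ht.2).trans_lt (mem_ball_iff_norm.1 hu)
  have hsegΩ : ∀ t ∈ Set.Icc (0 : ℝ) 1, u₀ + t • (u - u₀) ∈ Ω := fun t ht =>
    (hball _ (hseg t ht)).2.2
  have hline : ∀ t : ℝ, HasDerivAt (fun s : ℝ => u₀ + s • (u - u₀)) (u - u₀) t := fun t => by
    simpa using ((hasDerivAt_id t).smul_const (u - u₀)).const_add u₀
  have hlinec : ContinuousOn (fun s : ℝ => u₀ + s • (u - u₀)) (Set.Icc 0 1) := fun t _ =>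
    (hline t).continuousAt.continuousWithinAt
  have e0 : u₀ + (0 : ℝ) • (u - u₀) = u₀ := by simp
  have e1 : u₀ + (1 : ℝ) • (u - u₀) = u := by simp
  have key := mem_leafSet_of_curve hJ hS ha hint (c := c)
    (γ := fun t : ℝ => h (u₀ + t • (u - u₀)))
    (γ' := fun t : ℝ => fderiv ℝ h (u₀ + t • (u - u₀)) (u - u₀)) (by simpa only [e0] using hc)
    (fun t ht => by
      have hd : HasFDerivAt h (fderiv ℝ h (u₀ + t • (u - u₀))) (u₀ + t • (u - u₀)) :=
        ((hh.differentiableOn (by simp)).differentiableAt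
          (hΩ.mem_nhds (hsegΩ t ht))).hasFDerivAt
      have hd' := hd.comp_hasDerivAt t (hline t)
      exact hd'.hasDerivWithinAt)
    (((hh.continuousOn_fderiv_of_isOpen hΩ (by simp)).comp hlinec hsegΩ).clm_apply
      continuousOn_const)
    (fun t ht => hT _ (hsegΩ t ht)) (fun t ht => hD _ (hsegΩ t ht) _)
    (fun t ht => (hfin _ (hsegΩ t ht)).trans (hfin _ (hsegΩ 0 ⟨le_rfl, zero_le_one⟩)).symm) hδ
    (fun t ht w hw => by
      simp only [e0] at hw ⊢
      rw [← hG] at hw ⊢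
      exact (hball _ (hseg t ht)).1 w hw)
    (fun w hw hw0 => by
      simp only [e0, e1] at hw hw0
      rw [← hG] at hw hw0
      have := (hball _ hu).2.1 w hw
      rw [hw0, norm_zero] at this
      exact norm_eq_zero.1 (le_antisymm (nonpos_of_mul_nonpos_right this hδ') (norm_nonneg _)))
  simpa only [e0, e1] using key

open scoped Topology in
/-- An immersed integral manifold is locally contained in the leaf set of each of its points. -/
theorem eventually_integralManifold_mem_leafSet (hJ : J ∈ twistorSpace V) (hS : S ∈ admissibleS J)
    (ha : ∀ i, ContDiffOn ℝ ∞ (a i) (twistorSpace V))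
    (hint : ∀ i, ∀ L ∈ twistorSpace V, ∀ B ∈ distribution S L,
      fderivWithin ℝ (a i) (twistorSpace V) L B = 0)
    {d : ℕ} {N : Type*} [TopologicalSpace N] [ChartedSpace (EuclideanSpace ℝ (Fin d)) N]
    [IsManifold (𝓡 d) ∞ N] {ι : N → V →L[ℝ] V} (hι : ContMDiff (𝓡 d) 𝓘(ℝ, V →L[ℝ] V) ∞ ι)
    (hιT : ∀ x, ι x ∈ twistorSpace V)
    (hιD : ∀ x : N, Function.Injective (mfderiv (𝓡 d) 𝓘(ℝ, V →L[ℝ] V) ι x) ∧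
      Set.range (mfderiv (𝓡 d) 𝓘(ℝ, V →L[ℝ] V) ι x) =
        (distribution (leafField J a S) (ι x) : Set (V →L[ℝ] V))) (x : N) :
    ∀ᶠ y in 𝓝 x, ι y ∈ leafSet (leafField J a S) (ι x) := by
  have hfin : ∀ y, Module.finrank ℝ (distribution (leafField J a S) (ι y)) = d := by
    intro y
    let A : EuclideanSpace ℝ (Fin d) →ₗ[ℝ] (V →L[ℝ] V) :=
      (mfderiv (𝓡 d) 𝓘(ℝ, V →L[ℝ] V) ι y).toLinearMap
    have hA : A.range = distribution (leafField J a S) (ι y) := by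
      apply SetLike.coe_injective
      rw [LinearMap.coe_range]
      exact (hιD y).2
    rw [← hA, LinearMap.finrank_range_of_inj (f := A) (hιD y).1, finrank_euclideanSpace_fin]
  have hsymm := contMDiffOn_extChartAt_symm (I := 𝓡 d) (n := ∞) x
  have hopen := isOpen_extChartAt_target (I := 𝓡 d) x
  have hcomp : ContMDiffOn 𝓘(ℝ, EuclideanSpace ℝ (Fin d)) 𝓘(ℝ, V →L[ℝ] V) ∞
      (ι ∘ (extChartAt (𝓡 d) x).symm) (extChartAt (𝓡 d) x).target := hι.comp_contMDiffOn hsymm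
  have hev := eventually_mem_leafSet hJ hS ha hint hopen (contMDiffOn_iff_contDiffOn.1 hcomp)
    (fun u _ => hιT _) (fun u hu w => by
      have hd : MDifferentiableAt 𝓘(ℝ, EuclideanSpace ℝ (Fin d)) (𝓡 d)
          (extChartAt (𝓡 d) x).symm u :=
        ((hsymm.contMDiffAt (hopen.mem_nhds hu))).mdifferentiableAt (by simp)
      have hd' : MDifferentiableAt (𝓡 d) 𝓘(ℝ, V →L[ℝ] V) ι ((extChartAt (𝓡 d) x).symm u) :=
        (hι _).mdifferentiableAt (by simp)
      have hchain := mfderiv_comp u hd' hd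
      rw [mfderiv_eq_fderiv] at hchain
      rw [← SetLike.mem_coe, Function.comp_apply, ← (hιD _).2, hchain]
      exact ⟨_, rfl⟩)
    (fun u _ => hfin _) (mem_extChartAt_target x)
  have hcont := continuousAt_extChartAt (I := 𝓡 d) x
  filter_upwards [hcont.eventually hev, extChartAt_source_mem_nhds (I := 𝓡 d) x] with y hy hys
  simpa only [Function.comp_apply, (extChartAt (𝓡 d) x).left_inv hys,
    extChartAt_to_inv] using hy

theorem integralManifold_subset_component (hJ : J ∈ twistorSpace V) (hS : S ∈ admissibleS J)
    (ha : ∀ i, ContDiffOn ℝ ∞ (a i) (twistorSpace V))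
    (hint : ∀ i, ∀ L ∈ twistorSpace V, ∀ B ∈ distribution S L,
      fderivWithin ℝ (a i) (twistorSpace V) L B = 0)
    {K : V →L[ℝ] V} (hK : K ∈ twistorSpace V) {Y : Set (V →L[ℝ] V)}
    (hY : IsConnectedIntegralManifold (twistorSpace V) (distribution (leafField J a S)) Y)
    (hne : (connectedComponentIn (leafSet (leafField J a S) K) K ∩ Y).Nonempty) :
    Y ⊆ connectedComponentIn (leafSet (leafField J a S) K) K := by
  obtain ⟨hYT, d, N, _, _, ι, _, _, _, hconn, hι, -, hrange, hιD⟩ := hY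
  have hrel := leafField_relations hJ hS a
  have hιT : ∀ x, ι x ∈ twistorSpace V := fun x => hYT (hrange ▸ ⟨x, rfl⟩)
  have hloc := eventually_integralManifold_mem_leafSet hJ hS ha hint hι hιT hιD
  obtain ⟨q, hqX, hqY⟩ := hne
  have hclopen : IsClopen {x | ι x ∈ leafSet (leafField J a S) K} := by
    constructor
    · rw [← isOpen_compl_iff, isOpen_iff_mem_nhds]
      intro x hx
      filter_upwards [hloc x] with y hy hyK
      refine hx ?_
      have h1 := leafSet_eq_of_mem hrel hK hyK
      have h2 := leafSet_eq_of_mem hrel (hιT x) hy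
      exact h1 ▸ h2 ▸ self_mem_leafSet hrel (hιT x)
    · rw [isOpen_iff_mem_nhds]
      intro x hx
      filter_upwards [hloc x] with y hy
      exact leafSet_eq_of_mem hrel hK hx ▸ hy
  have huniv := hclopen.eq_univ (by
    rw [← hrange] at hqY
    obtain ⟨x, rfl⟩ := hqY
    exact ⟨x, connectedComponentIn_subset (leafSet (leafField J a S) K) K hqX⟩)
  have hsub : Y ⊆ leafSet (leafField J a S) K := by
    rw [← hrange]
    rintro _ ⟨x, rfl⟩
    have : x ∈ {x | ι x ∈ leafSet (leafField J a S) K} := huniv ▸ Set.mem_univ x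
    exact this
  have hpre : IsPreconnected Y := by
    rw [← hrange]
    exact isPreconnected_range hι.continuous
  rw [connectedComponentIn_eq hqX]
  exact hpre.subset_connectedComponentIn hqY hsub

end Maximality

end

end Twistor

/- For `a` smooth on `T(V)` and `B` tangent to `T(V)` at `L`, the number
`fderivWithin ℝ a (twistorSpace V) L B` is the derivative of `a` along `B`: all derivatives of `a`
within `T(V)` agree on tangent vectors. -/
theorem theorem6p1 {V : Type u} [NormedAddCommGroup V] [InnerProductSpace ℝ V]
    [FiniteDimensional ℝ V]
    (J : V →L[ℝ] V) (hJ : J ∈ Twistor.twistorSpace V)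
    (S : (V →L[ℝ] V) → (V →L[ℝ] V)) (hS : S ∈ Twistor.admissibleS J)
    (k : ℕ) (a : Fin (k + 1) → (V →L[ℝ] V) → ℝ)
    (ha : ∀ i, ContDiffOn ℝ ∞ (a i) (Twistor.twistorSpace V))
    (hint : ∀ i, ∀ L ∈ Twistor.twistorSpace V, ∀ B ∈ Twistor.distribution S L,
      fderivWithin ℝ (a i) (Twistor.twistorSpace V) L B = 0)
    (QS : (V →L[ℝ] V) → (V →L[ℝ] V)) (hQS : QS = fun L => Twistor.polyQ J a L * S L)
    (K : V →L[ℝ] V) (hK : K ∈ Twistor.twistorSpace V) :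
    Twistor.IsLeaf (Twistor.twistorSpace V) (Twistor.distribution QS) K
        (connectedComponentIn (Twistor.leafSet QS K) K) ∧
      Twistor.IsComplexSubmanifold (connectedComponentIn (Twistor.leafSet QS K) K) := by
  subst hQS
  have hrel := Twistor.leafField_relations hJ hS a
  have hball := fun p hp => Twistor.exists_cayley_mem_leafSet hJ hS ha hint (p := p) hp
  refine ⟨⟨Twistor.isConnectedIntegralManifold_component hrel hK hball,
    mem_connectedComponentIn (Twistor.self_mem_leafSet hrel hK), fun Y hY hne => ?_⟩,
    Twistor.isComplexSubmanifold_component hrel hK hball⟩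
  exact Twistor.integralManifold_subset_component hJ hS ha hint hK hY hne
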